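/- Let $G=(\mathcal V,\mathcal E)$ be a simple directed graph (no self-loops) with $n\ge 2$ nodes, and let $f\ge 0$. Write $A\overset{f+1}{\to}B$ if at least $f+1$ distinct nodes of $A\setminus B$ have an edge into $B$. Condition CCA says: for every partition $L,C,R$ of $\mathcal V$ with $L,R\neq\emptyset$, either $L\cup C\overset{f+1}{\to}R$ or $R\cup C\overset{f+1}{\to}L$. *Model.* Nodes exchange messages over the edges of $G$ asynchronously: delays are arbitrary and finite, messages need not arrive in order, and every message to a fault-free node is eventually delivered. At most $f$ nodes crash, at any time, possibly in the middle of sending; a fault-free node keeps taking steps. Initially a node $i$ knows only itself, its input $v_i[0]$, its sets of incoming neighbours $N_i^-$ and outgoing neighbours, and (as part of the algorithm) $f$; messages may be relayed without limit. An algorithm lets each node compute states $v_i[0],v_i[1],v_i[2],\dots$ successively, $v_i[0]$ being set when the node starts. $F[p]$ is the set of nodes that never compute $v_i[p]$; $U[p]$ and $\mu[p]$ are the maximum and minimum of $v_i[p]$ over $i\notin F[p]$. *Validity*: $U[p]\le U[0]$ and $\mu[p]\ge\mu[0]$ for all $p>0$. *Convergence*: $\lim_{p\to\infty}(U[p]-\mu[p])=0$.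 An algorithm *solves approximate consensus on $G$* if in every execution every fault-free node computes $v_i[p]$ for all $p$ and Validity holds, and for all inputs and every $\varepsilon>0$ there is a phase $p_\varepsilon$, the same for all executions with these inputs, such that $U[p]-\mu[p]<\varepsilon$ for all $p>p_\varepsilon$. *Algorithm LWA.* On entering phase $p\ge1$, node $i$ puts $R_i[p]=\{v_i[p-1]\}$ (a multiset), $heard_i[p]=\{i\}$, $G^i[p]=$ the graph with nodes $N_i^-\cup\{i\}$ and an edge from each node of $N_i^-$ to $i$, and sends $(v_i[p-1],N_i^-,i,p)$ to all outgoing neighbours. When $i$ receives a message $(h,N,j,p)$ for the first time (its own messages do not count as new, and messages of a phase that $i$ has not yet entered are kept for that phase), it adds $h$ to $R_i[p]$, $j$ to $heard_i[p]$, the nodes $N\cup\{j\}$ and the edges $(k,j)$, $k\in N$, to $G^i[p]$, and sends the message on to all its outgoing neighbours. When, for the first time in phase $p$, there is a set $F_i$ of at most $f$ nodes of $G^i[p]$ other than $i$ such that every node having a path to $i$ in the subgraph of $G^i[p]$ induced by the nodes outside $F_i$ lies in $heard_i[p]$ (Condition $n$-WAIT), node $i$ sets $v_i[p]$ to the average of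 $R_i[p]$ and enters phase $p+1$. Let $heard_i^*[p]$ be $heard_i[p]$ at that moment. *Claim.* 1. Suppose that $G$ satisfies Condition CCA. Then in every execution of LWA with at most $f$ crashes: for every $p\ge1$ and all $i,j\in\mathcal V\setminus F[p]$, $heard^*_i[p]\cap heard^*_j[p]\neq\emptyset$; every fault-free node computes $v_i[p]$ for every $p$; and Validity and Convergence hold. Moreover LWA solves approximate consensus on $G$. 2. Condition CCA is tight: some algorithm in which nodes initially have only one-hop knowledge solves approximate consensus on $G$ if and only if $G$ satisfies Condition CCA. -/

import Mathlib

/-!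
Asynchronous crash-prone message passing on a directed graph, Condition CCA,
approximate consensus, and Algorithm LWA (Learn-Wait-Average).
-/

universe u

namespace AsyncConsensus

/-! ## Graph conditions -/

section Graph

variable {V : Type u}

/-- The incoming neighbours of the set `B` (nodes outside `B` with an edge into `B`)
that lie in `A`. -/
def inNbrsOfSet (G : Digraph V) (A B : Set V) : Set V :=
  {a | a ∈ A ∧ a ∉ B ∧ ∃ b ∈ B, G.Adj a b}

/-- `B` has at least `k` distinct incoming neighbours in `A`. -/
def PointsTo (G : Digraph V) (A B : Set V) (k : ℕ) : Prop :=
  k ≤ (inNbrsOfSet G A B).ncard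

/-- Condition CCA with fault bound `f`. -/
def CCA (G : Digraph V) (f : ℕ) : Prop :=
  ∀ L C R : Set V, Disjoint L C → Disjoint L R → Disjoint C R → L ∪ C ∪ R = Set.univ →
    L.Nonempty → R.Nonempty →
      PointsTo G (L ∪ C) R (f + 1) ∨ PointsTo G (R ∪ C) L (f + 1)

variable [Fintype V]

open Classical in
/-- One-hop incoming neighbours of `i`. -/
noncomputable def inNbrs (G : Digraph V) (i : V) : Finset V :=
  Finset.univ.filter fun j => G.Adj j i

open Classical in
/-- One-hop outgoing neighbours of `i`. -/
noncomputable def outNbrs (G : Digraph V) (i : V) : Finset V :=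
  Finset.univ.filter fun j => G.Adj i j

end Graph

/-! ## Asynchronous algorithms with one-hop topology knowledge -/

/-- The effect of one local step: the next local state, the messages to be sent to each
node, and possibly a new state value (`some y` ends the current phase with value `y`). -/
structure Action (V : Type u) (State Msg : Type u) where
  next : State
  send : V → Multiset Msg
  commit : Option ℝ

/-- A deterministic message-passing algorithm with one-hop topology knowledge.
A node starts with its identity, its one-hop incoming and outgoing neighbours, and its
input; later it acts on its local state, either spontaneously (`none`) or upon receiving a
message `m` over the link from `j` (`some (j, m)`).  The graph itself is not available. -/
structure Protocol (V : Type u) where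
  State : Type u
  Msg : Type u
  start : (self : V) → (inN outN : Finset V) → (input : ℝ) → State × (V → Multiset Msg)
  step : State → Option (V × Msg) → Action V State Msg

/-- A global configuration: local states (`none` before the node has started), the sequence
`v_i[0], v_i[1], …` of state values computed so far, the messages in transit from one node
to another, and the nodes that have crashed. -/
structure Config {V : Type u} (P : Protocol V) where
  loc : V → Option P.State
  vals : V → List ℝ
  chan : V → V → Multiset P.Msg
  crashed : Set V

/-- What makes a node act. -/
inductive Trigger {V : Type u} (P : Protocol V) where
  | start
  | tick
  | recv (j : V) (m : P.Msg)

/-- Events of an execution. In `actCrash` the node crashes while it is sending the messages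
of its step; in `crash` it crashes between two steps. -/
inductive Event {V : Type u} (P : Protocol V) where
  | idle
  | crash (i : V)
  | act (i : V) (τ : Trigger P)
  | actCrash (i : V) (τ : Trigger P)

section Semantics

variable {V : Type u} [Fintype V] {P : Protocol V}

/-- Nobody has started, and no message is in transit. -/
def Config.initial (P : Protocol V) : Config P where
  loc := fun _ => none
  vals := fun _ => []
  chan := fun _ _ => 0
  crashed := ∅

open Classical in
/-- The step that node `i` takes in configuration `c` on trigger `τ`; `none` if the trigger
is not possible. Starting sets `v_i[0]` to the input `x i`. -/
noncomputable def Config.response (c : Config P) (G : Digraph V) (x : V → ℝ) (i : V) :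
    Trigger P → Option (Action V P.State P.Msg)
  | .start =>
      match c.loc i with
      | none =>
          let s := P.start i (inNbrs G i) (outNbrs G i) (x i)
          some ⟨s.1, s.2, some (x i)⟩
      | some _ => none
  | .tick => (c.loc i).map fun s => P.step s none
  | .recv j m => if m ∈ c.chan j i then (c.loc i).map fun s => P.step s (some (j, m)) else none

open Classical in
/-- The messages in transit from `j` to `k`, after `i` has consumed the message (if any) that
triggered its step. -/
noncomputable def Config.consume (c : Config P) (i : V) (τ : Trigger P) (j k : V) :
    Multiset P.Msg :=
  match τ with
  | .recv j' m => if j = j' ∧ k = i then (c.chan j k).erase m else c.chan j k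
  | _ => c.chan j k

open Classical in
/-- Node `i` carries out the action `a`, and the messages `sent` actually leave the node.
Messages travel only along edges of `G`. -/
noncomputable def Config.perform (c : Config P) (G : Digraph V) (i : V) (τ : Trigger P)
    (a : Action V P.State P.Msg) (sent : V → Multiset P.Msg) : Config P where
  loc := Function.update c.loc i (some a.next)
  vals := Function.update c.vals i (c.vals i ++ a.commit.toList)
  chan := fun j k => c.consume i τ j k + if j = i ∧ G.Adj i k then sent k else 0
  crashed := c.crashed

/-- One transition of the system. A node that crashes in the middle of a step may have sent
only a part of the messages of that step. -/
inductive Step (G : Digraph V) (x : V → ℝ) : Config P → Event P → Config P → Prop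
  | idle (c : Config P) : Step G x c .idle c
  | crash (c : Config P) (i : V) (hi : i ∉ c.crashed) :
      Step G x c (.crash i) { c with crashed := insert i c.crashed }
  | act (c : Config P) (i : V) (τ : Trigger P) (a : Action V P.State P.Msg)
      (hi : i ∉ c.crashed) (ha : c.response G x i τ = some a) :
      Step G x c (.act i τ) (c.perform G i τ a a.send)
  | actCrash (c : Config P) (i : V) (τ : Trigger P) (a : Action V P.State P.Msg)
      (sent : V → Multiset P.Msg) (hi : i ∉ c.crashed)
      (ha : c.response G x i τ = some a) (hs : ∀ k, sent k ≤ a.send k) :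
      Step G x c (.actCrash i τ)
        { c.perform G i τ a sent with crashed := insert i c.crashed }

/-- An infinite execution of `P` on `G` with inputs `x`. -/
structure Run (P : Protocol V) (G : Digraph V) (x : V → ℝ) where
  cfg : ℕ → Config P
  ev : ℕ → Event P
  init : cfg 0 = Config.initial P
  step : ∀ t, Step G x (cfg t) (ev t) (cfg (t + 1))

namespace Run

variable {G : Digraph V} {x : V → ℝ}

/-- The nodes that crash at some time. -/
def faulty (r : Run P G x) : Set V := {i | ∃ t, i ∈ (r.cfg t).crashed}

/-- At most `f` nodes crash; a fault-free node keeps taking steps, and every message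
addressed to a fault-free node is eventually delivered. -/
structure Admissible (r : Run P G x) (f : ℕ) : Prop where
  few_faults : r.faulty.ncard ≤ f
  keeps_going : ∀ i ∉ r.faulty, ∀ t, ∃ t' ≥ t, r.ev t' = .act i .tick
  delivered : ∀ i ∉ r.faulty, ∀ t j m, m ∈ (r.cfg t).chan j i →
    ∃ t' ≥ t, r.ev t' = .act i (.recv j m)

/-- `v_i[p] = y`: node `i` has computed its state of phase `p`, and it is `y`. -/
def HasState (r : Run P G x) (i : V) (p : ℕ) (y : ℝ) : Prop :=
  ∃ t, ((r.cfg t).vals i)[p]? = some y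

/-- `F[p]`: the nodes that never compute `v_i[p]`; the other nodes are those that have not
crashed by the end of phase `p`. -/
def F (r : Run P G x) (p : ℕ) : Set V := {i | ∀ y, ¬ r.HasState i p y}

/-- The states `v_i[p]` of the nodes outside `F[p]`. -/
def states (r : Run P G x) (p : ℕ) : Set ℝ := {y | ∃ i, r.HasState i p y}

/-- `U[p]`, the maximum state in phase `p`. -/
noncomputable def U (r : Run P G x) (p : ℕ) : ℝ := sSup (r.states p)

/-- `μ[p]`, the minimum state in phase `p`. -/
noncomputable def mu (r : Run P G x) (p : ℕ) : ℝ := sInf (r.states p)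

/-- Every fault-free node computes its state in every phase. -/
def Progress (r : Run P G x) : Prop := ∀ i ∉ r.faulty, ∀ p, i ∉ r.F p

/-- Validity. (If all nodes have crashed then there is no maximum or minimum state.) -/
def Validity (r : Run P G x) : Prop :=
  ∀ p > 0, (r.states p).Nonempty → r.U p ≤ r.U 0 ∧ r.mu 0 ≤ r.mu p

/-- Convergence in a single execution. -/
def Convergence (r : Run P G x) : Prop :=
  Filter.Tendsto (fun p => r.U p - r.mu p) Filter.atTop (nhds 0)

/-- At time `t`, node `i` computes its state `v_i[p]`. -/
def ComputesAt (r : Run P G x) (i : V) (p t : ℕ) : Prop :=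
  ((r.cfg t).vals i).length = p ∧ ((r.cfg (t + 1)).vals i).length = p + 1

end Run

/-- `P` solves asynchronous approximate consensus on `G` with up to `f` crashes: every
fault-free node completes every phase, Validity holds, and for all inputs and every `ε > 0`
there is a phase `pε` (not depending on delays and crashes) after which the states
differ by less than `ε`. -/
def SolvesApproxConsensus (P : Protocol V) (G : Digraph V) (f : ℕ) : Prop :=
  ∀ x : V → ℝ,
    (∀ r : Run P G x, r.Admissible f → r.Progress ∧ r.Validity) ∧
    ∀ ε : ℝ, 0 < ε → ∃ pε : ℕ, ∀ r : Run P G x, r.Admissible f →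
      ∀ p > pε, r.U p - r.mu p < ε

end Semantics

/-! ## Algorithm LWA -/

/-- A directed graph together with its set of nodes. -/
structure EstGraph (V : Type u) where
  verts : Set V
  edge : V → V → Prop

/-- The star graph `G_{N ⇒ j}`: nodes `N ∪ {j}` and an edge from each node of `N` to `j`. -/
def EstGraph.star {V : Type u} (N : Finset V) (j : V) : EstGraph V where
  verts := {k | k ∈ N ∨ k = j}
  edge := fun a b => a ∈ N ∧ b = j

/-- The nodes that have a path to `i` in the subgraph induced by `verts - S`. -/
def EstGraph.reach {V : Type u} (H : EstGraph V) (i : V) (S : Finset V) : Set V :=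
  {k | k ∈ H.verts ∧ k ∉ S ∧
    Relation.ReflTransGen
      (fun a b => H.edge a b ∧ (a ∈ H.verts ∧ a ∉ S) ∧ (b ∈ H.verts ∧ b ∉ S)) k i}

/-- Condition `n`-WAIT at node `i` on the estimated graph `H`. -/
def EstGraph.Wait {V : Type u} (H : EstGraph V) (f : ℕ) (i : V) (heard : Set V) : Prop :=
  ∃ S : Finset V, (∀ k ∈ S, k ∈ H.verts ∧ k ≠ i) ∧ S.card ≤ f ∧ H.reach i S ⊆ heard

/-- The message `(h, N, j, p)`. -/
structure LWAMsg (V : Type u) where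
  value : ℝ
  nbrs : Finset V
  origin : V
  phase : ℕ

/-- Local state of LWA: the one-hop knowledge, the current phase, the messages handled so far
(for all phases; the node's own messages count as handled when it sends them), and
the messages that have arrived but have not been handled yet. -/
structure LWAState (V : Type u) where
  self : V
  inN : Finset V
  outN : Finset V
  phase : ℕ
  handled : Finset (LWAMsg V)
  inbox : List (LWAMsg V)

namespace LWAState

variable {V : Type u}

/-- `heard_i[p]`. -/
def heard (s : LWAState V) (p : ℕ) : Set V :=
  {j | ∃ m ∈ s.handled, m.phase = p ∧ m.origin = j}

/-- The multiset `R_i[p]`. -/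
def R (s : LWAState V) (p : ℕ) : Multiset ℝ :=
  (s.handled.filter fun m => m.phase = p).val.map fun m => m.value

/-- The estimated graph `G^i[p]`: the union of the stars learned from the phase `p`
messages, including the node's own. -/
def est (s : LWAState V) (p : ℕ) : EstGraph V where
  verts := {k | ∃ m ∈ s.handled, m.phase = p ∧ k ∈ (EstGraph.star m.nbrs m.origin).verts}
  edge := fun a b => ∃ m ∈ s.handled, m.phase = p ∧ (EstGraph.star m.nbrs m.origin).edge a b

/-- Condition `n`-WAIT holds in the current phase. -/
def Wait (s : LWAState V) (f : ℕ) : Prop :=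
  (s.est s.phase).Wait f s.self (s.heard s.phase)

open Classical in
/-- Send `m` to all outgoing neighbours. -/
noncomputable def broadcast (s : LWAState V) (m : LWAMsg V) : V → Multiset (LWAMsg V) :=
  fun k => if k ∈ s.outN then {m} else 0

/-- The node's own message of phase `p`, where `v` is its state `v_i[p-1]`. -/
def ownMsg (s : LWAState V) (p : ℕ) (v : ℝ) : LWAMsg V := ⟨v, s.inN, s.self, p⟩

open Classical in
/-- Enter phase `p` with state `v = v_i[p-1]`. -/
noncomputable def enter (s : LWAState V) (p : ℕ) (v : ℝ) : LWAState V :=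
  { s with phase := p, handled := insert (s.ownMsg p v) s.handled }

/-- The average of `R_i[p]` for the current phase `p`. -/
noncomputable def average (s : LWAState V) : ℝ :=
  (s.R s.phase).sum / (s.R s.phase).card

open Classical in
/-- A local step. If Condition `n`-WAIT holds, then compute the new state and enter the next
phase. Otherwise handle the next message that has arrived, if there is one: if it is
received for the first time then record it (for the phase it belongs to) and relay it. -/
noncomputable def tick (f : ℕ) (s : LWAState V) : Action V (LWAState V) (LWAMsg V) :=
  if s.Wait f then
    ⟨s.enter (s.phase + 1) s.average,
      s.broadcast (s.ownMsg (s.phase + 1) s.average), some s.average⟩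
  else
    match s.inbox with
    | [] => ⟨s, fun _ => 0, none⟩
    | m :: rest =>
        if m ∈ s.handled then ⟨{ s with inbox := rest }, fun _ => 0, none⟩
        else ⟨{ s with inbox := rest, handled := insert m s.handled }, s.broadcast m, none⟩

end LWAState

/-- Algorithm LWA with fault bound `f`. On starting, a node enters phase `1` with its input
as state; an arriving message is put at the end of the inbox. -/
noncomputable def LWA {V : Type u} (f : ℕ) : Protocol V where
  State := LWAState V
  Msg := LWAMsg V
  start := fun i inN outN v =>
    let s : LWAState V := ⟨i, inN, outN, 0, ∅, []⟩
    (s.enter 1 v, s.broadcast (s.ownMsg 1 v))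
  step := fun s e =>
    match e with
    | none => s.tick f
    | some (_, m) => ⟨{ s with inbox := s.inbox ++ [m] }, fun _ => 0, none⟩

/-- `heard*_i[p]`: the set `heard_i[p]` at the time when Condition `n`-WAIT first holds in
phase `p`, so that node `i` computes `v_i[p]`. -/
def heardStar {V : Type u} [Fintype V] {f : ℕ} {G : Digraph V} {x : V → ℝ}
    (r : Run (LWA f) G x) (i : V) (p : ℕ) : Set V :=
  {k | ∃ t, ∃ s : LWAState V, r.ComputesAt i p t ∧ (r.cfg t).loc i = some s ∧ k ∈ s.heard p}

end AsyncConsensus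

namespace AsyncConsensus

/-! ### Steps, monotonicity of runs, and the states computed in them -/

section Runs

variable {V : Type u} {P : Protocol V} {G : Digraph V} {x : V → ℝ}

/-! Sufficiency of CCA. Suppose that Condition `n`-WAIT holds at a node with witness `S`, and let
`L` be the set of nodes that reach it outside `S` in its estimated graph. All of `L` has been heard,
and each message carries the complete in-neighbourhood of its origin. So an in-neighbour of `L` that
is not in `S` would reach the node as well, and `L` has at most `f` incoming neighbours
(`LWAState.Inv.exists_closed`). Under CCA two nonempty sets of this kind meet
(`CCA.inter_nonempty`), so any two nodes that finish a phase average over a common value. With `n`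
nodes this shrinks the range of the states by the factor `1 - 1/n` (`CCA.U_sub_mu_succ_le`). The
initial range is bounded in terms of the inputs alone, so the phase `pε` does not depend on the
execution.

Progress goes by induction on the phase. Messages flood along fault-free paths, and once everything
that can arrive has arrived, the faulty nodes witness WAIT (`LWAState.Inv.wait_of_heard`). One point
needs care: a tick tests WAIT before it looks at the inbox, so a node for which WAIT always held
would never read its messages. CCA excludes this: a node with an in-neighbour has more than `f` of
them, so WAIT fails in a phase in which it has heard only itself (`Run.exists_head_handled`).

Necessity. If CCA fails, there are disjoint nonempty `L` and `R` with at most `f` incoming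
neighbours each. Consider the run in which all inputs are `v` and the in-neighbours of `L` crash at
once. By Validity, `L` computes `v` in every phase without outside messages. The same steps of `L`
are possible in a crash-free run in which everything else is merely slow. Replaying such steps for
`L` with value `0` and then for `R` with value `1` yields a run whose states still differ by `1` in
a phase fixed beforehand (`SolvesApproxConsensus.cca`). A fair scheduler turns these finite scripts
into admissible executions. -/

theorem Config.consume_le (c : Config P) (i : V) (τ : Trigger P) (j k : V) :
    c.consume i τ j k ≤ c.chan j k := by
  classical
  unfold Config.consume
  cases τ with
  | start => exact le_rfl
  | tick => exact le_rfl
  | recv j' m =>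
    dsimp only
    split_ifs
    · exact Multiset.erase_le _ _
    · exact le_rfl

theorem Config.mem_consume_or (c : Config P) (i : V) (τ : Trigger P) {j k : V} {m : P.Msg}
    (hm : m ∈ c.chan j k) : m ∈ c.consume i τ j k ∨ (τ = .recv j m ∧ k = i) := by
  classical
  unfold Config.consume
  cases τ with
  | start => exact Or.inl hm
  | tick => exact Or.inl hm
  | recv j' m' =>
    dsimp only
    split_ifs with h
    · obtain ⟨rfl, rfl⟩ := h
      by_cases hmm : m = m'
      · subst hmm; exact Or.inr ⟨rfl, rfl⟩
      · exact Or.inl ((Multiset.mem_erase_of_ne hmm).2 hm)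
    · exact Or.inl hm

variable [Fintype V]

/-- Node `i` carries out the action `a` on trigger `τ`, possibly crashing meanwhile. -/
structure Performs (G : Digraph V) (x : V → ℝ) (c c' : Config P) (i : V) (τ : Trigger P)
    (a : Action V P.State P.Msg) (sent : V → Multiset P.Msg) : Prop where
  alive : i ∉ c.crashed
  resp : c.response G x i τ = some a
  sent_le : ∀ k, sent k ≤ a.send k
  sent_eq : i ∉ c'.crashed → sent = a.send
  crashed : c.crashed ⊆ c'.crashed
  loc : c'.loc = (c.perform G i τ a sent).loc
  vals : c'.vals = (c.perform G i τ a sent).vals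
  chan : c'.chan = (c.perform G i τ a sent).chan

/-- A crash in the middle of a step differs from a complete step only in that fewer messages leave
the node. Treating both as `Performs` spares every invariant a case. -/
theorem Step.idle_or_performs {c c' : Config P} {e : Event P} (h : Step G x c e c') :
    (c'.loc = c.loc ∧ c'.vals = c.vals ∧ c'.chan = c.chan ∧ c.crashed ⊆ c'.crashed) ∨
    ∃ i τ a sent, Performs G x c c' i τ a sent := by
  cases h with
  | idle => exact Or.inl ⟨rfl, rfl, rfl, subset_rfl⟩
  | crash i hi => exact Or.inl ⟨rfl, rfl, rfl, Set.subset_insert _ _⟩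
  | act i τ a hi ha =>
    exact Or.inr ⟨i, τ, a, a.send, hi, ha, fun _ => le_rfl, fun _ => rfl, subset_rfl,
      rfl, rfl, rfl⟩
  | actCrash i τ a sent hi ha hs =>
    exact Or.inr ⟨i, τ, a, sent, hi, ha, hs, fun h => (h (Set.mem_insert _ _)).elim,
      Set.subset_insert _ _, rfl, rfl, rfl⟩

theorem Step.crashed_subset {c c' : Config P} {e : Event P} (h : Step G x c e c') :
    c.crashed ⊆ c'.crashed := by
  rcases h.idle_or_performs with ⟨-, -, -, h⟩ | ⟨i, τ, a, sent, h⟩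
  exacts [h, h.crashed]

theorem Performs.loc_self {c c' : Config P} {i : V} {τ : Trigger P}
    {a : Action V P.State P.Msg} {sent : V → Multiset P.Msg}
    (h : Performs G x c c' i τ a sent) : c'.loc i = some a.next := by
  classical
  simp [h.loc, Config.perform]

theorem Performs.loc_of_ne {c c' : Config P} {i k : V} {τ : Trigger P}
    {a : Action V P.State P.Msg} {sent : V → Multiset P.Msg}
    (h : Performs G x c c' i τ a sent) (hk : k ≠ i) : c'.loc k = c.loc k := by
  classical
  simp [h.loc, Config.perform, hk]

theorem Performs.vals_self {c c' : Config P} {i : V} {τ : Trigger P}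
    {a : Action V P.State P.Msg} {sent : V → Multiset P.Msg}
    (h : Performs G x c c' i τ a sent) : c'.vals i = c.vals i ++ a.commit.toList := by
  classical
  simp [h.vals, Config.perform]

theorem Performs.vals_of_ne {c c' : Config P} {i k : V} {τ : Trigger P}
    {a : Action V P.State P.Msg} {sent : V → Multiset P.Msg}
    (h : Performs G x c c' i τ a sent) (hk : k ≠ i) : c'.vals k = c.vals k := by
  classical
  simp [h.vals, Config.perform, hk]

theorem Performs.mem_chan {c c' : Config P} {i j k : V} {τ : Trigger P}
    {a : Action V P.State P.Msg} {sent : V → Multiset P.Msg} {m : P.Msg}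
    (h : Performs G x c c' i τ a sent) (hm : m ∈ c'.chan j k) :
    m ∈ c.chan j k ∨ (j = i ∧ G.Adj j k ∧ m ∈ a.send k) := by
  classical
  rw [h.chan] at hm
  simp only [Config.perform] at hm
  rcases Multiset.mem_add.1 hm with hm | hm
  · exact Or.inl (Multiset.mem_of_le (c.consume_le i τ j k) hm)
  · split_ifs at hm with hc
    · exact Or.inr ⟨hc.1, hc.1 ▸ hc.2, Multiset.mem_of_le (h.sent_le k) hm⟩
    · simp at hm

theorem Performs.mem_chan_of_mem {c c' : Config P} {i j k : V} {τ : Trigger P}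
    {a : Action V P.State P.Msg} {sent : V → Multiset P.Msg} {m : P.Msg}
    (h : Performs G x c c' i τ a sent) (hm : m ∈ c.chan j k) :
    m ∈ c'.chan j k ∨ (τ = .recv j m ∧ k = i) := by
  classical
  rw [h.chan]
  simp only [Config.perform]
  rcases c.mem_consume_or i τ hm with hm | hm
  · exact Or.inl (Multiset.mem_add.2 (Or.inl hm))
  · exact Or.inr hm

theorem Performs.mem_chan_of_send {c c' : Config P} {i k : V} {τ : Trigger P}
    {a : Action V P.State P.Msg} {sent : V → Multiset P.Msg} {m : P.Msg}
    (h : Performs G x c c' i τ a sent) (hi : i ∉ c'.crashed) (hadj : G.Adj i k)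
    (hm : m ∈ a.send k) : m ∈ c'.chan i k := by
  classical
  rw [h.chan]
  simp only [Config.perform]
  refine Multiset.mem_add.2 (Or.inr ?_)
  rwa [h.sent_eq hi, if_pos (by simpa using hadj)]

theorem Step.vals_succ {c c' : Config P} {e : Event P} (h : Step G x c e c') (i : V) :
    c'.vals i = c.vals i ∨ ∃ y, c'.vals i = c.vals i ++ [y] := by
  rcases h.idle_or_performs with ⟨-, h, -, -⟩ | ⟨k, τ, a, sent, h⟩
  · exact Or.inl (by rw [h])
  · by_cases hk : i = k
    · subst hk
      rw [h.vals_self]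
      cases a.commit with
      | none => exact Or.inl (by simp)
      | some y => exact Or.inr ⟨y, by simp⟩
    · exact Or.inl (h.vals_of_ne hk)

theorem Step.vals_prefix {c c' : Config P} {e : Event P} (h : Step G x c e c') (i : V) :
    c.vals i <+: c'.vals i := by
  rcases h.vals_succ i with h | ⟨y, h⟩ <;> simp [h]

theorem Step.loc_isSome {c c' : Config P} {e : Event P} (h : Step G x c e c') {i : V}
    (hi : c.loc i ≠ none) : c'.loc i ≠ none := by
  rcases h.idle_or_performs with ⟨h, -, -, -⟩ | ⟨k, τ, a, sent, h⟩
  · rwa [h]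
  · by_cases hk : i = k
    · subst hk; simp [h.loc_self]
    · rwa [h.loc_of_ne hk]

theorem getElem?_of_prefix {α : Type*} {l l' : List α} (h : l <+: l') {n : ℕ} {y : α}
    (hy : l[n]? = some y) : l'[n]? = some y := by
  obtain ⟨r, rfl⟩ := h
  rw [List.getElem?_append_left (List.getElem?_eq_some_iff.1 hy).1, hy]

namespace Run

theorem vals_prefix (r : Run P G x) (i : V) {s t : ℕ} (hst : s ≤ t) :
    (r.cfg s).vals i <+: (r.cfg t).vals i := by
  induction t, hst using Nat.le_induction with
  | base => exact List.prefix_rfl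
  | succ t _ ih => exact ih.trans ((r.step t).vals_prefix i)

theorem loc_isSome_mono (r : Run P G x) {i : V} {s t : ℕ} (hst : s ≤ t)
    (hi : (r.cfg s).loc i ≠ none) : (r.cfg t).loc i ≠ none := by
  induction t, hst using Nat.le_induction with
  | base => exact hi
  | succ t _ ih => exact (r.step t).loc_isSome ih

theorem HasState.unique {r : Run P G x} {i : V} {p : ℕ} {y z : ℝ} (hy : r.HasState i p y)
    (hz : r.HasState i p z) : y = z := by
  obtain ⟨s, hs⟩ := hy
  obtain ⟨t, ht⟩ := hz
  have h1 := getElem?_of_prefix (r.vals_prefix i (le_max_left s t)) hs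
  have h2 := getElem?_of_prefix (r.vals_prefix i (le_max_right s t)) ht
  rw [h1] at h2
  exact Option.some_injective _ h2

theorem states_finite (r : Run P G x) (p : ℕ) : (r.states p).Finite := by
  classical
  refine (Set.finite_range fun i => if h : ∃ y, r.HasState i p y then h.choose else 0).subset ?_
  rintro y ⟨i, hi⟩
  have h : ∃ y, r.HasState i p y := ⟨y, hi⟩
  exact ⟨i, by simp only [dif_pos h]; exact h.choose_spec.unique hi⟩

theorem le_U {r : Run P G x} {i : V} {p : ℕ} {y : ℝ} (h : r.HasState i p y) : y ≤ r.U p :=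
  le_csSup (r.states_finite p).bddAbove ⟨i, h⟩

theorem mu_le {r : Run P G x} {i : V} {p : ℕ} {y : ℝ} (h : r.HasState i p y) : r.mu p ≤ y :=
  csInf_le (r.states_finite p).bddBelow ⟨i, h⟩

theorem hasState_of_lt {r : Run P G x} {i : V} {p t : ℕ} (h : p < ((r.cfg t).vals i).length) :
    ∃ y, r.HasState i p y :=
  ⟨_, t, List.getElem?_eq_getElem h⟩

/-- The moment at which a state is computed. -/
theorem HasState.exists_computesAt {r : Run P G x} {i : V} {p : ℕ} {y : ℝ}
    (h : r.HasState i p y) :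
    ∃ t, r.ComputesAt i p t ∧ (r.cfg (t + 1)).vals i = (r.cfg t).vals i ++ [y] := by
  classical
  have hex : ∃ t, p < ((r.cfg t).vals i).length := by
    obtain ⟨t, ht⟩ := h
    exact ⟨t, (List.getElem?_eq_some_iff.1 ht).1⟩
  have hspec := Nat.find_spec hex
  have hmin := fun t (ht : t < Nat.find hex) => Nat.find_min hex ht
  rcases hT : Nat.find hex with _ | t
  · rw [hT, r.init] at hspec
    simp [Config.initial] at hspec
  · rw [hT] at hspec hmin
    have h1 := hmin t (Nat.lt_succ_self t)
    rcases (r.step t).vals_succ i with h2 | ⟨z, h2⟩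
    · rw [h2] at hspec; exact absurd hspec h1
    · have hl : ((r.cfg t).vals i).length = p := by
        rw [h2] at hspec; simp at hspec; omega
      have hz : r.HasState i p z := ⟨t + 1, by rw [h2, ← hl]; simp⟩
      obtain rfl := hz.unique h
      exact ⟨t, ⟨hl, by rw [h2]; simp [hl]⟩, h2⟩

/-- The only trigger to which an unstarted node responds is `start`, which commits the input;
afterwards the list of states only grows at its end. -/
theorem started_vals (r : Run P G x) (t : ℕ) (i : V) :
    ((r.cfg t).loc i = none ∧ (r.cfg t).vals i = []) ∨
      ((r.cfg t).loc i ≠ none ∧ ∃ l, (r.cfg t).vals i = x i :: l) := by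
  classical
  induction t with
  | zero => rw [r.init]; exact Or.inl ⟨rfl, rfl⟩
  | succ t ih =>
    rcases (r.step t).idle_or_performs with ⟨h1, h2, -, -⟩ | ⟨k, τ, a, sent, h⟩
    · rwa [h1, h2]
    · by_cases hk : i = k
      · subst hk
        rw [h.loc_self, h.vals_self]
        refine Or.inr ⟨by simp, ?_⟩
        rcases ih with ⟨h1, h2⟩ | ⟨h1, l, h2⟩
        · have hr := h.resp
          cases τ with
          | start =>
            simp only [Config.response, h1, Option.some.injEq] at hr
            subst hr
            simp [h2]
          | tick => simp [Config.response, h1] at hr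
          | recv j m => simp [Config.response, h1] at hr
        · exact ⟨_, by rw [h2]; rfl⟩
      · rwa [h.loc_of_ne hk, h.vals_of_ne hk]

theorem HasState.zero {r : Run P G x} {i : V} {y : ℝ} (h : r.HasState i 0 y) : y = x i := by
  obtain ⟨t, ht⟩ := h
  rcases r.started_vals t i with ⟨-, h⟩ | ⟨-, l, h⟩
  · simp [h] at ht
  · simpa [h] using ht.symm

end Run

end Runs

/-! ### A fair scheduler -/

section Scheduler

variable {V : Type u} [Fintype V] {P : Protocol V}

open Classical in
/-- Carry out the instruction `e` if that is possible; the second component is the event that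
really happens. -/
noncomputable def Config.exec (G : Digraph V) (x : V → ℝ) (c : Config P) :
    Event P → Config P × Event P
  | .crash i =>
      if i ∈ c.crashed then (c, .idle) else ({ c with crashed := insert i c.crashed }, .crash i)
  | .act i τ =>
      if i ∈ c.crashed then (c, .idle)
      else match c.response G x i τ with
        | none => (c, .idle)
        | some a => (c.perform G i τ a a.send, .act i τ)
  | _ => (c, .idle)

/-- Carry out a list of instructions. -/
noncomputable def Config.execList (G : Digraph V) (x : V → ℝ) (c : Config P)
    (l : List (Event P)) : Config P :=
  l.foldl (fun c e => (c.exec G x e).1) c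

/-- Start every node, let every node take a step, and deliver all messages in transit. -/
noncomputable def Config.refill (c : Config P) : List (Event P) :=
  (Finset.univ : Finset V).toList.map (fun i => .act i .start) ++
    ((Finset.univ : Finset V).toList.map (fun i => .act i .tick) ++
      (Finset.univ : Finset (V × V)).toList.flatMap fun q =>
        (c.chan q.1 q.2).toList.map fun m => .act q.2 (.recv q.1 m))

/-- One step of the scheduler, which works off a list of instructions. -/
noncomputable def schedNext (G : Digraph V) (x : V → ℝ) :
    Config P × List (Event P) → Config P × List (Event P)
  | (c, []) => (c, c.refill)
  | (c, e :: l) => ((c.exec G x e).1, l)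

/-- The event that belongs to one step of the scheduler. -/
noncomputable def schedEvent (G : Digraph V) (x : V → ℝ) :
    Config P × List (Event P) → Event P
  | (_, []) => .idle
  | (c, e :: _) => (c.exec G x e).2

variable {G : Digraph V} {x : V → ℝ}

theorem Config.step_exec (c : Config P) (e : Event P) :
    Step G x c (c.exec G x e).2 (c.exec G x e).1 := by
  cases e with
  | idle => exact .idle c
  | actCrash i τ => exact .idle c
  | crash i =>
    unfold Config.exec
    dsimp only
    split_ifs with h
    · exact .idle c
    · exact .crash c i h
  | act i τ =>
    unfold Config.exec
    dsimp only
    split_ifs with h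
    · exact .idle c
    · split
      · exact .idle c
      · next a ha => exact .act c i τ a h ha

theorem step_sched (s : Config P × List (Event P)) :
    Step G x s.1 (schedEvent G x s) (schedNext G x s).1 := by
  obtain ⟨c, _ | ⟨e, l⟩⟩ := s
  · exact .idle c
  · exact c.step_exec e

/-- The run that first carries out the instructions `pre` and then is fair. -/
noncomputable def schedRun (P : Protocol V) (G : Digraph V) (x : V → ℝ)
    (pre : List (Event P)) : Run P G x where
  cfg t := ((schedNext G x)^[t] (Config.initial P, pre)).1
  ev t := schedEvent G x ((schedNext G x)^[t] (Config.initial P, pre))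
  init := rfl
  step t := by
    rw [Function.iterate_succ_apply']
    exact step_sched _

theorem schedNext_iterate (l l' : List (Event P)) (c : Config P) :
    (schedNext G x)^[l.length] (c, l ++ l') = (c.execList G x l, l') := by
  induction l generalizing c with
  | nil => rfl
  | cons e l ih =>
    rw [List.length_cons, Function.iterate_succ_apply]
    exact ih _

theorem schedRun_cfg_length (l l' : List (Event P)) :
    (schedRun P G x (l ++ l')).cfg l.length = (Config.initial P).execList G x l := by
  simp only [schedRun, schedNext_iterate]

/-- Every instruction that is pending after a refill gets its turn. -/
theorem schedRun_exists_turn (pre : List (Event P)) (t : ℕ) :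
    ∃ t₀ ≥ t, ∀ e ∈ ((schedRun P G x pre).cfg t₀).refill, ∃ t' ≥ t,
      (schedRun P G x pre).ev t' = (((schedRun P G x pre).cfg t').exec G x e).2 := by
  set σ : ℕ → Config P × List (Event P) :=
    fun t => (schedNext G x)^[t] (Config.initial P, pre) with hσ
  have hadd : ∀ a b, σ (a + b) = (schedNext G x)^[a] (σ b) := fun a b => by
    simp only [hσ, Function.iterate_add_apply]
  -- At `t₀` the instructions pending at time `t` are used up, so the next step is a refill.
  set t₀ := (σ t).2.length + t with ht₀
  have h0 : (σ t₀).2 = [] := by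
    have h := schedNext_iterate (G := G) (x := x) (σ t).2 [] (σ t).1
    rw [List.append_nil] at h
    rw [ht₀, hadd]
    exact congrArg Prod.snd h
  have h1 : σ (1 + t₀) = ((σ t₀).1, (σ t₀).1.refill) := by
    rw [hadd]
    show schedNext G x (σ t₀) = _
    rw [show σ t₀ = ((σ t₀).1, []) from Prod.ext rfl h0]
    rfl
  refine ⟨t₀, by omega, fun e he => ?_⟩
  obtain ⟨l1, l2, hl⟩ := List.append_of_mem he
  -- One step for the refill, then one for each instruction listed before `e`.
  refine ⟨l1.length + (1 + t₀), by omega, ?_⟩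
  have h2 : σ (l1.length + (1 + t₀)) = ((σ t₀).1.execList G x l1, e :: l2) := by
    rw [hadd, h1, ← schedNext_iterate (G := G) (x := x) l1 (e :: l2), ← hl]
    rfl
  change schedEvent G x (σ (l1.length + (1 + t₀))) =
    (Config.exec G x (σ (l1.length + (1 + t₀))).1 e).2
  rw [h2]
  rfl

theorem crash_mem_of_mem_crashed_exec {c : Config P} {e : Event P} {i : V}
    (h : i ∈ (c.exec G x e).1.crashed) : i ∈ c.crashed ∨ e = .crash i := by
  cases e with
  | idle => exact Or.inl h
  | actCrash j τ => exact Or.inl h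
  | crash j =>
    unfold Config.exec at h
    dsimp only at h
    split_ifs at h with hj
    · exact Or.inl h
    · rcases h with rfl | h
      exacts [Or.inr rfl, Or.inl h]
  | act j τ =>
    unfold Config.exec at h
    dsimp only at h
    split_ifs at h with hj
    · exact Or.inl h
    · split at h <;> exact Or.inl h

theorem crash_not_mem_refill (c : Config P) (i : V) : Event.crash i ∉ c.refill := by
  simp [Config.refill]

/-- A refill never contains a crash, so every crash that has occurred or is pending stems from
`pre`. -/
theorem schedRun_faulty_subset (pre : List (Event P)) :
    (schedRun P G x pre).faulty ⊆ {i | Event.crash i ∈ pre} := by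
  rintro i ⟨t, ht⟩
  have key : ∀ t, (i ∈ ((schedNext G x)^[t] (Config.initial P, pre)).1.crashed ∨
      Event.crash i ∈ ((schedNext G x)^[t] (Config.initial P, pre)).2) →
      Event.crash i ∈ pre := by
    intro t
    induction t with
    | zero =>
      rintro (h | h)
      · exact absurd h (Set.notMem_empty i)
      · exact h
    | succ t ih =>
      rw [Function.iterate_succ_apply']
      generalize (schedNext G x)^[t] (Config.initial P, pre) = σ at ih ⊢
      obtain ⟨c, _ | ⟨e, l⟩⟩ := σ
      · rintro (h | h)
        · exact ih (Or.inl h)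
        · exact absurd h (crash_not_mem_refill c i)
      · rintro (h | h)
        · rcases crash_mem_of_mem_crashed_exec h with h | h
          · exact ih (Or.inl h)
          · exact ih (Or.inr (by simp [h]))
        · exact ih (Or.inr (List.mem_cons_of_mem _ h))
  exact key t (Or.inl ht)

theorem Config.exec_act_of_response {c : Config P} {i : V} {τ : Trigger P}
    {a : Action V P.State P.Msg} (hi : i ∉ c.crashed) (ha : c.response G x i τ = some a) :
    c.exec G x (.act i τ) = (c.perform G i τ a a.send, .act i τ) := by
  simp [Config.exec, hi, ha]

theorem Config.exists_response_start {c : Config P} {i : V} (h : c.loc i = none) :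
    ∃ a, c.response G x i .start = some a := by
  simp [Config.response, h]

theorem Config.exists_response_tick {c : Config P} {i : V} (h : c.loc i ≠ none) :
    ∃ a, c.response G x i .tick = some a := by
  obtain ⟨s, hs⟩ := Option.ne_none_iff_exists'.1 h
  simp [Config.response, hs]

theorem Config.exists_response_recv {c : Config P} {i j : V} {m : P.Msg} (h : c.loc i ≠ none)
    (hm : m ∈ c.chan j i) : ∃ a, c.response G x i (.recv j m) = some a := by
  obtain ⟨s, hs⟩ := Option.ne_none_iff_exists'.1 h
  simp [Config.response, hs, hm]

/-- A message stays in transit until it is received. -/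
theorem Step.mem_chan_or_received {c c' : Config P} {e : Event P} (h : Step G x c e c')
    {i j : V} {m : P.Msg} (hm : m ∈ c.chan j i) :
    m ∈ c'.chan j i ∨ e = .act i (.recv j m) ∨ i ∈ c'.crashed := by
  cases h with
  | idle => exact Or.inl hm
  | crash k hk => exact Or.inl hm
  | act k τ a hk ha =>
    rcases c.mem_consume_or k τ hm with h | ⟨rfl, rfl⟩
    · exact Or.inl (Multiset.mem_add.2 (Or.inl h))
    · exact Or.inr (Or.inl rfl)
  | actCrash k τ a sent hk ha hs =>
    rcases c.mem_consume_or k τ hm with h | ⟨rfl, rfl⟩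
    · exact Or.inl (Multiset.mem_add.2 (Or.inl h))
    · exact Or.inr (Or.inr (Set.mem_insert _ _))

/-- Every refill lists all starts, all ticks and all messages in transit. At a fault-free node, a
tick stays possible once the node has started, and a delivery stays possible until it happens, so
neither is missed when its turn comes. -/
theorem schedRun_admissible (pre : List (Event P)) {f : ℕ}
    (hf : {i | Event.crash i ∈ pre}.ncard ≤ f) : (schedRun P G x pre).Admissible f := by
  set r := schedRun P G x pre with hr
  have hstart : ∀ i ∉ r.faulty, ∃ t, (r.cfg t).loc i ≠ none := by
    intro i hi
    by_contra! hnone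
    obtain ⟨t₀, -, h⟩ := schedRun_exists_turn (G := G) (x := x) pre 0
    obtain ⟨t', -, ht'⟩ := h (.act i .start) (by simp [Config.refill])
    rw [← hr] at ht'
    obtain ⟨a, ha⟩ := Config.exists_response_start (G := G) (x := x) (hnone t')
    rw [Config.exec_act_of_response (fun h => hi ⟨t', h⟩) ha] at ht'
    have hs := r.step t'
    rw [ht'] at hs
    have hn := hnone (t' + 1)
    generalize r.cfg (t' + 1) = c' at hs hn
    cases hs with
    | act _ _ a _ _ => simp [Config.perform] at hn
  constructor
  · exact (Set.ncard_le_ncard (schedRun_faulty_subset pre) (Set.toFinite _)).trans hf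
  · intro i hi t
    obtain ⟨s, hs⟩ := hstart i hi
    obtain ⟨t₀, -, h⟩ := schedRun_exists_turn (G := G) (x := x) pre (max s t)
    obtain ⟨t', hle, ht'⟩ := h (.act i .tick) (by simp [Config.refill])
    rw [← hr] at ht'
    obtain ⟨a, ha⟩ := Config.exists_response_tick (G := G) (x := x)
      (r.loc_isSome_mono ((le_max_left s t).trans hle) hs)
    rw [Config.exec_act_of_response (fun h => hi ⟨t', h⟩) ha] at ht'
    exact ⟨t', (le_max_right s t).trans hle, ht'⟩
  · intro i hi t j m hm
    -- A message that is never received stays in transit, hence is listed in a later refill and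
    -- still deliverable at its turn.
    by_contra! hnot
    have hstay : ∀ t' ≥ t, m ∈ (r.cfg t').chan j i := by
      intro t' ht'
      induction t', ht' using Nat.le_induction with
      | base => exact hm
      | succ t' hle ih =>
        rcases (r.step t').mem_chan_or_received ih with h | h | h
        · exact h
        · exact absurd h (hnot t' hle)
        · exact absurd ⟨_, h⟩ hi
    obtain ⟨s, hs⟩ := hstart i hi
    obtain ⟨t₀, ht₀, h⟩ := schedRun_exists_turn (G := G) (x := x) pre (max s t)
    have hm₀ := hstay t₀ ((le_max_right s t).trans ht₀)
    obtain ⟨t', hle, ht'⟩ := h (.act i (.recv j m)) (by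
      simp only [Config.refill, List.mem_append, List.mem_flatMap]
      exact Or.inr (Or.inr ⟨(j, i), by simp, by simpa using hm₀⟩))
    rw [← hr] at ht'
    obtain ⟨a, ha⟩ := Config.exists_response_recv (G := G) (x := x)
      (r.loc_isSome_mono ((le_max_left s t).trans hle) hs)
      (hstay t' ((le_max_right s t).trans hle))
    rw [Config.exec_act_of_response (fun h => hi ⟨t', h⟩) ha] at ht'
    exact hnot t' ((le_max_right s t).trans hle) ht'

end Scheduler

/-! ### Necessity of Condition CCA -/

section Necessity

variable {V : Type u} {P : Protocol V}

/-- The event is a step of a node of `L`, not triggered by a message from outside `L`. -/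
def Event.Within (L : Set V) : Event P → Prop
  | .act i τ => i ∈ L ∧ ∀ j m, τ = .recv j m → j ∈ L
  | _ => False

/-- `L` cannot receive any message from the outside. -/
structure Config.Isolated (G : Digraph V) (L : Set V) (c : Config P) : Prop where
  chan : ∀ j ∉ L, ∀ i ∈ L, c.chan j i = 0
  crashed : ∀ j ∉ L, ∀ i ∈ L, G.Adj j i → j ∈ c.crashed

/-- The configurations `c` and `d` look the same to the nodes of `L`, which are alive in `d`. -/
structure AgreeOn (L : Set V) (c d : Config P) : Prop where
  loc : ∀ i ∈ L, c.loc i = d.loc i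
  vals : ∀ i ∈ L, c.vals i = d.vals i
  chan : ∀ j ∈ L, ∀ i ∈ L, c.chan j i = d.chan j i
  alive : ∀ i ∈ L, i ∉ d.crashed

theorem AgreeOn.trans {L : Set V} {c d e : Config P} (h : AgreeOn L c d) (h' : AgreeOn L d e) :
    AgreeOn L c e where
  loc i hi := (h.loc i hi).trans (h'.loc i hi)
  vals i hi := (h.vals i hi).trans (h'.vals i hi)
  chan j hj i hi := (h.chan j hj i hi).trans (h'.chan j hj i hi)
  alive := h'.alive

theorem Config.consume_of_ne (c : Config P) {i k : V} (τ : Trigger P) (j : V) (h : k ≠ i) :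
    c.consume i τ j k = c.chan j k := by
  classical
  unfold Config.consume
  cases τ <;> simp [h]

theorem Config.consume_congr {c d : Config P} {i j k : V} (τ : Trigger P)
    (h : c.chan j k = d.chan j k) : c.consume i τ j k = d.consume i τ j k := by
  classical
  unfold Config.consume
  cases τ <;> simp [h]

variable [Fintype V] {G : Digraph V} {x y : V → ℝ}

theorem AgreeOn.response_eq {L : Set V} {c d : Config P} (h : AgreeOn L c d) {i : V}
    {τ : Trigger P} (hw : (Event.act i τ).Within L) (hxy : x i = y i) :
    c.response G x i τ = d.response G y i τ := by
  classical
  cases τ with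
  | start => simp only [Config.response, h.loc i hw.1, hxy]
  | tick => simp only [Config.response, h.loc i hw.1]
  | recv j m =>
    simp only [Config.response, h.loc i hw.1, h.chan j (hw.2 j m rfl) i hw.1]

/-- The outside nodes with an edge into `L` have crashed, so a step outside `L` leaves no trace in
`L` and is dropped. A step inside `L` depends only on data on which `c` and `d` agree, and is
copied. Since its node survives in `c'`, all its messages were sent in both systems. -/
theorem AgreeOn.exists_simulation {L : Set V} {c c' d : Config P} {e : Event P}
    (hxy : ∀ i ∈ L, x i = y i) (hstep : Step G x c e c') (hiso : c.Isolated G L)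
    (hag : AgreeOn L c d) (halive : ∀ i ∈ L, i ∉ c'.crashed) :
    c'.Isolated G L ∧ ∃ l : List (Event P), (∀ e ∈ l, e.Within L) ∧
      AgreeOn L c' (d.execList G y l) := by
  classical
  rcases hstep.idle_or_performs with ⟨h1, h2, h3, h4⟩ | ⟨k, τ, a, sent, h⟩
  · refine ⟨⟨fun j hj i hi => by rw [h3]; exact hiso.chan j hj i hi,
      fun j hj i hi hji => h4 (hiso.crashed j hj i hi hji)⟩, [], by simp, ?_⟩
    exact ⟨by rw [h1]; exact hag.loc, by rw [h2]; exact hag.vals, by rw [h3]; exact hag.chan,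
      hag.alive⟩
  · have hchan : ∀ j i, c'.chan j i =
        c.consume k τ j i + if j = k ∧ G.Adj k i then sent i else 0 := fun j i => by
      rw [h.chan]; rfl
    refine ⟨⟨fun j hj i hi => ?_, fun j hj i hi hji => h.crashed (hiso.crashed j hj i hi hji)⟩, ?_⟩
    · rw [hchan, if_neg, add_zero]
      · have := c.consume_le k τ j i
        rwa [hiso.chan j hj i hi, Multiset.le_zero] at this
      · rintro ⟨rfl, hadj⟩
        exact h.alive (hiso.crashed j hj i hi hadj)
    · by_cases hk : k ∈ L
      · have hw : (Event.act k τ).Within L := by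
          refine ⟨hk, ?_⟩
          rintro j m rfl
          -- A message from outside `L` would have to be in transit, but those channels are empty.
          by_contra hj
          have hr := h.resp
          simp [Config.response, hiso.chan j hj k hk] at hr
        have hresp : d.response G y k τ = some a := by
          rw [← hag.response_eq hw (hxy k hk)]; exact h.resp
        refine ⟨[.act k τ], by simpa using hw, ?_⟩
        have hexec : d.execList G y [.act k τ] = d.perform G k τ a a.send :=
          congrArg Prod.fst (Config.exec_act_of_response (hag.alive k hk) hresp)
        rw [hexec]
        refine ⟨fun i hi => ?_, fun i hi => ?_, fun j hj i hi => ?_, hag.alive⟩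
        · by_cases hik : i = k
          · subst hik; simp [h.loc_self, Config.perform]
          · simp [h.loc_of_ne hik, Config.perform, hik, hag.loc i hi]
        · by_cases hik : i = k
          · subst hik; simp [h.vals_self, Config.perform, hag.vals i hi]
          · simp [h.vals_of_ne hik, Config.perform, hik, hag.vals i hi]
        · rw [hchan, h.sent_eq (halive k hk), Config.consume_congr τ (hag.chan j hj i hi)]
          rfl
      · refine ⟨[], by simp, fun i hi => ?_, fun i hi => ?_, fun j hj i hi => ?_, hag.alive⟩
        · rw [h.loc_of_ne (by rintro rfl; exact hk hi)]; exact hag.loc i hi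
        · rw [h.vals_of_ne (by rintro rfl; exact hk hi)]; exact hag.vals i hi
        · rw [hchan, if_neg (by rintro ⟨rfl, -⟩; exact hk hj), add_zero,
            c.consume_of_ne τ j (by rintro rfl; exact hk hi)]
          exact hag.chan j hj i hi

theorem Config.execList_append (c : Config P) (l l' : List (Event P)) :
    c.execList G x (l ++ l') = (c.execList G x l).execList G x l' := by
  simp [Config.execList, List.foldl_append]

theorem Run.exists_replay {r : Run P G x} {L : Set V} (hxy : ∀ i ∈ L, x i = y i)
    (hL : ∀ i ∈ L, i ∉ r.faulty) {t₀ : ℕ} {d : Config P} (hiso : (r.cfg t₀).Isolated G L)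
    (hag : AgreeOn L (r.cfg t₀) d) (t : ℕ) (ht : t₀ ≤ t) :
    (r.cfg t).Isolated G L ∧ ∃ l : List (Event P), (∀ e ∈ l, e.Within L) ∧
      AgreeOn L (r.cfg t) (d.execList G y l) := by
  induction t, ht using Nat.le_induction with
  | base => exact ⟨hiso, [], by simp, hag⟩
  | succ t _ ih =>
    obtain ⟨hi, l, hl, ha⟩ := ih
    obtain ⟨hi', l', hl', ha'⟩ :=
      ha.exists_simulation hxy (r.step t) hi (fun i hi h => hL i hi ⟨_, h⟩)
    refine ⟨hi', l ++ l', ?_, ?_⟩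
    · intro e he
      rcases List.mem_append.1 he with he | he
      exacts [hl e he, hl' e he]
    · rwa [Config.execList_append]

/-- Steps of nodes of `L` do not concern the nodes of a disjoint set. -/
theorem agreeOn_execList_of_disjoint {L R : Set V} (hLR : Disjoint L R) {l : List (Event P)}
    (hl : ∀ e ∈ l, e.Within L) {d : Config P} (hd : ∀ i ∈ R, i ∉ d.crashed) :
    AgreeOn R d (d.execList G x l) := by
  classical
  induction l generalizing d with
  | nil => exact ⟨fun _ _ => rfl, fun _ _ => rfl, fun _ _ _ _ => rfl, hd⟩
  | cons e l ih =>
    have hstep : AgreeOn R d (d.exec G x e).1 := by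
      have hw := hl e (by simp)
      cases e with
      | idle => exact hw.elim
      | crash i => exact hw.elim
      | actCrash i τ => exact hw.elim
      | act k τ =>
        have hne : ∀ i ∈ R, i ≠ k := by
          rintro i hi rfl
          exact Set.disjoint_left.1 hLR hw.1 hi
        unfold Config.exec
        dsimp only
        split_ifs with hk
        · exact ⟨fun _ _ => rfl, fun _ _ => rfl, fun _ _ _ _ => rfl, hd⟩
        · split
          · exact ⟨fun _ _ => rfl, fun _ _ => rfl, fun _ _ _ _ => rfl, hd⟩
          · refine ⟨fun i hi => ?_, fun i hi => ?_, fun j hj i hi => ?_, hd⟩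
            · simp [Config.perform, hne i hi]
            · simp [Config.perform, hne i hi]
            · simp [Config.perform, hne j hj, d.consume_of_ne τ j (hne i hi)]
    exact hstep.trans (ih (fun e he => hl e (List.mem_cons_of_mem _ he)) hstep.alive)

theorem execList_crash (l : List V) (c : Config P) :
    c.execList G x (l.map .crash) = { c with crashed := c.crashed ∪ {i | i ∈ l} } := by
  classical
  induction l generalizing c with
  | nil => simp [Config.execList]
  | cons i l ih =>
    have h : c.execList G x ((i :: l).map .crash) =
        (c.exec G x (.crash i)).1.execList G x (l.map .crash) := rfl
    rw [h, ih]
    unfold Config.exec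
    dsimp only
    split_ifs with hi
    · congr 1
      ext k
      simp only [Set.mem_union, Set.mem_ofPred_eq, List.mem_cons]
      constructor
      · tauto
      · rintro (h | rfl | h) <;> tauto
    · congr 1
      ext k
      simp only [Set.mem_union, Set.mem_ofPred_eq, List.mem_cons, Set.mem_insert_iff]
      tauto

/-- If a set has at most `f` incoming neighbours, then a node of it can be made to compute,
without hearing from outside the set, the common input of the set as its state of
any given phase. -/
theorem SolvesApproxConsensus.exists_isolated_computation {f : ℕ}
    (hP : SolvesApproxConsensus P G f) {L : Set V}
    (hf : (inNbrsOfSet G Set.univ L).ncard ≤ f) {v : ℝ} (hxv : ∀ i ∈ L, x i = v) {i : V}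
    (hi : i ∈ L) (p : ℕ) {d : Config P} (hd : AgreeOn L (Config.initial P) d) :
    ∃ l : List (Event P), (∀ e ∈ l, e.Within L) ∧
      ((d.execList G x l).vals i)[p]? = some v ∧ ∀ j ∈ L, j ∉ (d.execList G x l).crashed := by
  classical
  set B := (inNbrsOfSet G Set.univ L).toFinset.toList with hB
  have hmemB : ∀ j, j ∈ B ↔ j ∈ inNbrsOfSet G Set.univ L := by simp [hB]
  -- The auxiliary run: all inputs are `v`, and the incoming neighbours of `L` crash before anything
  -- else happens.
  set r := schedRun P G (fun _ => v) (B.map .crash) with hr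
  have hpre : {j | (Event.crash j : Event P) ∈ B.map Event.crash} =
      inNbrsOfSet G Set.univ L := by
    ext j; simp [hmemB]
  have hadm : r.Admissible f := schedRun_admissible _ (by rw [hpre]; exact hf)
  obtain ⟨hprog, hval⟩ := (hP fun _ => v).1 r hadm
  have hfaulty : ∀ j ∈ L, j ∉ r.faulty := by
    intro j hj h
    have h' := schedRun_faulty_subset _ h
    rw [hpre] at h'
    exact h'.2.1 hj
  -- All initial states are `v`, so Validity squeezes the later ones; phase `0` is separate because
  -- Validity only concerns `p > 0`.
  have hconst : ∀ z, r.HasState i p z → z = v := by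
    intro z hz
    have h0 : ∀ w ∈ r.states 0, w = v := by
      rintro w ⟨j, hj⟩
      exact hj.zero
    rcases Nat.eq_zero_or_pos p with rfl | hp
    · exact h0 z ⟨i, hz⟩
    · obtain ⟨h1, h2⟩ := hval p hp ⟨z, i, hz⟩
      obtain ⟨w, hw⟩ : ∃ w, r.HasState i 0 w := by
        have := hprog i (hfaulty i hi) 0
        simpa [Run.F] using this
      have hs : r.states 0 = {v} := by
        ext u
        refine ⟨h0 u, ?_⟩
        rintro rfl
        exact ⟨i, hw.zero ▸ hw⟩
      have hU : r.U 0 = v := by simp [Run.U, hs]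
      have hmu : r.mu 0 = v := by simp [Run.mu, hs]
      exact le_antisymm ((Run.le_U hz).trans (h1.trans hU.le))
        (hmu.ge.trans (h2.trans (Run.mu_le hz)))
  obtain ⟨z, hz⟩ : ∃ z, r.HasState i p z := by
    have := hprog i (hfaulty i hi) p
    simpa [Run.F] using this
  obtain rfl := hconst z hz
  obtain ⟨T, hT⟩ := hz
  have hcfg : r.cfg (B.map Event.crash : List (Event P)).length =
      { Config.initial P with crashed := (Config.initial P).crashed ∪ {j | j ∈ B} } := by
    rw [← execList_crash (G := G) (x := fun _ => z)]
    have := schedRun_cfg_length (P := P) (G := G) (x := fun _ => z) (B.map .crash) []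
    rwa [List.append_nil] at this
  set t₀ := (B.map Event.crash : List (Event P)).length
  have hiso : (r.cfg t₀).Isolated G L := by
    rw [hcfg]
    refine ⟨fun _ _ _ _ => rfl, fun j hj k hk hjk => Or.inr ?_⟩
    exact (hmemB j).2 ⟨trivial, hj, k, hk, hjk⟩
  have hag : AgreeOn L (r.cfg t₀) d := by
    rw [hcfg]
    exact ⟨hd.loc, hd.vals, hd.chan, hd.alive⟩
  -- `L` is known to be isolated only from `t₀` on, when the crashes are done, so the replay starts
  -- there and lasts until the state of phase `p` is present.
  obtain ⟨-, l, hl, ha⟩ := Run.exists_replay (r := r) (y := x) (fun j hj => (hxv j hj).symm)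
    hfaulty hiso hag (max t₀ T) (le_max_left _ _)
  refine ⟨l, hl, ?_, ha.alive⟩
  rw [← ha.vals i hi]
  exact getElem?_of_prefix (r.vals_prefix i (le_max_right _ _)) hT

theorem SolvesApproxConsensus.cca {f : ℕ} (hP : SolvesApproxConsensus P G f) : CCA G f := by
  classical
  intro L C R hLC hLR hCR huniv ⟨i, hi⟩ ⟨j, hj⟩
  by_contra! hcon
  simp only [PointsTo, not_le, Nat.lt_succ_iff] at hcon
  obtain ⟨hR, hL⟩ := hcon
  have hR' : (inNbrsOfSet G Set.univ R).ncard ≤ f := by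
    refine (Set.ncard_le_ncard ?_ (Set.toFinite _)).trans hR
    rintro k ⟨-, hk, h⟩
    refine ⟨?_, hk, h⟩
    have : k ∈ L ∪ C ∪ R := huniv ▸ Set.mem_univ k
    exact this.resolve_right hk
  have hL' : (inNbrsOfSet G Set.univ L).ncard ≤ f := by
    refine (Set.ncard_le_ncard ?_ (Set.toFinite _)).trans hL
    rintro k ⟨-, hk, h⟩
    refine ⟨?_, hk, h⟩
    have : k ∈ L ∪ C ∪ R := huniv ▸ Set.mem_univ k
    rcases this with (h | h) | h
    exacts [absurd h hk, Or.inr h, Or.inl h]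
  set x : V → ℝ := fun k => if k ∈ R then 1 else 0 with hx
  obtain ⟨p₀, hp₀⟩ := (hP x).2 (1 / 2) (by norm_num)
  -- The phase depends only on the inputs and is fixed before the run is built; here the uniformity
  -- of `pε` over executions is essential.
  set p := p₀ + 1
  have hini : ∀ S : Set V, ∀ k ∈ S, k ∉ (Config.initial P).crashed :=
    fun _ k _ => Set.notMem_empty k
  obtain ⟨l, hl, hval, halive⟩ := hP.exists_isolated_computation (x := x) hL' (v := 0)
    (fun k hk => if_neg (Set.disjoint_left.1 hLR hk)) hi p
    (d := Config.initial P) ⟨fun _ _ => rfl, fun _ _ => rfl, fun _ _ _ _ => rfl, hini L⟩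
  obtain ⟨l', hl', hval', -⟩ := hP.exists_isolated_computation (x := x) hR' (v := 1)
    (fun k hk => if_pos hk) hj p (d := (Config.initial P).execList G x l)
    (agreeOn_execList_of_disjoint hLR hl (hini R))
  -- The steps of `R` leave the state `0` computed in `L` untouched.
  have hdis := agreeOn_execList_of_disjoint (G := G) (x := x) hLR.symm hl'
    (d := (Config.initial P).execList G x l) halive
  -- The scripts contain no crash, so the combined run is admissible for every `f`.
  have hno : {k | (Event.crash k : Event P) ∈ l ++ l'} = ∅ := by
    ext k
    simp only [Set.mem_ofPred_eq, Set.mem_empty_iff_false, iff_false, List.mem_append]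
    rintro (h | h)
    exacts [hl _ h, hl' _ h]
  set r := schedRun P G x (l ++ l') with hr
  have hadm : r.Admissible f := schedRun_admissible _ (by rw [hno]; simp)
  have hcfg : r.cfg (l ++ l').length =
      ((Config.initial P).execList G x l).execList G x l' := by
    have := schedRun_cfg_length (P := P) (G := G) (x := x) (l ++ l') []
    rwa [List.append_nil, Config.execList_append] at this
  have h0 : r.HasState i p 0 := ⟨_, by rw [hcfg, ← hdis.vals i hi]; exact hval⟩
  have h1 : r.HasState j p 1 := ⟨_, by rw [hcfg]; exact hval'⟩
  have hlt := hp₀ r hadm p (Nat.lt_succ_self _)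
  have hU := Run.le_U h1
  have hmu := Run.mu_le h0
  linarith

end Necessity

/-! ### Invariants of LWA -/

section LWAInvariants

variable {V : Type u}

theorem LWAState.mem_broadcast {s : LWAState V} {m m' : LWAMsg V} {k : V} :
    m' ∈ s.broadcast m k ↔ k ∈ s.outN ∧ m' = m := by
  classical
  unfold LWAState.broadcast
  split_ifs with h <;> simp [h]

theorem LWAState.mem_enter_handled {s : LWAState V} {p : ℕ} {v : ℝ} {m : LWAMsg V} :
    m ∈ (s.enter p v).handled ↔ m = s.ownMsg p v ∨ m ∈ s.handled := by
  classical
  simp [LWAState.enter]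

variable [Fintype V] {f : ℕ} {G : Digraph V} {x : V → ℝ}

/-- The possible steps of a node that runs LWA. -/
inductive LWAMove (G : Digraph V) (x : V → ℝ) (c : Config (LWA (V := V) f)) (i : V) :
    Trigger (LWA (V := V) f) → Action V (LWAState V) (LWAMsg V) → Prop
  | start (s : LWAState V) (hs : s = ⟨i, inNbrs G i, outNbrs G i, 0, ∅, []⟩)
      (h : c.loc i = none) :
      LWAMove G x c i .start
        ⟨s.enter 1 (x i), s.broadcast (s.ownMsg 1 (x i)), some (x i)⟩
  | commit (s : LWAState V) (h : c.loc i = some s) (hw : s.Wait f) :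
      LWAMove G x c i .tick ⟨s.enter (s.phase + 1) s.average,
        s.broadcast (s.ownMsg (s.phase + 1) s.average), some s.average⟩
  | skip (s : LWAState V) (h : c.loc i = some s) (hw : ¬ s.Wait f) (hin : s.inbox = []) :
      LWAMove G x c i .tick ⟨s, fun _ => 0, none⟩
  | duplicate (s : LWAState V) (m : LWAMsg V) (rest : List (LWAMsg V)) (h : c.loc i = some s)
      (hw : ¬ s.Wait f) (hin : s.inbox = m :: rest) (hm : m ∈ s.handled) :
      LWAMove G x c i .tick ⟨{ s with inbox := rest }, fun _ => 0, none⟩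
  | handle (s : LWAState V) (m : LWAMsg V) (rest : List (LWAMsg V))
      (handled : Finset (LWAMsg V)) (h : c.loc i = some s)
      (hw : ¬ s.Wait f) (hin : s.inbox = m :: rest) (hm : m ∉ s.handled)
      (hh : ∀ m', m' ∈ handled ↔ m' = m ∨ m' ∈ s.handled) :
      LWAMove G x c i .tick
        ⟨{ s with inbox := rest, handled := handled }, s.broadcast m, none⟩
  | recv (s : LWAState V) (j : V) (m : LWAMsg V) (h : c.loc i = some s) (hm : m ∈ c.chan j i) :
      LWAMove G x c i (.recv j m) ⟨{ s with inbox := s.inbox ++ [m] }, fun _ => 0, none⟩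

theorem LWAMove.of_response {c : Config (LWA (V := V) f)} {i : V}
    {τ : Trigger (LWA (V := V) f)} {a : Action V (LWAState V) (LWAMsg V)}
    (h : c.response G x i τ = some a) : LWAMove G x c i τ a := by
  classical
  cases τ with
  | start =>
    cases hl : c.loc i with
    | none =>
      simp only [Config.response, hl] at h
      obtain rfl := Option.some_injective _ h
      exact .start _ rfl hl
    | some s => simp [Config.response, hl] at h
  | tick =>
    cases hl : c.loc i with
    | none => simp [Config.response, hl] at h
    | some s =>
      simp only [Config.response, hl, Option.map_some] at h
      obtain rfl := Option.some_injective _ h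
      change LWAMove G x c i .tick (LWAState.tick f s)
      unfold LWAState.tick
      split_ifs with hw
      · exact .commit s hl hw
      · split
        · next hin => exact .skip s hl hw hin
        · next m rest hin =>
          split_ifs with hm
          · exact .duplicate s m rest hl hw hin hm
          · exact .handle s m rest _ hl hw hin hm (fun m' => Finset.mem_insert)
  | recv j m =>
    simp only [Config.response] at h
    split_ifs at h with hm
    cases hl : c.loc i with
    | none => simp [hl] at h
    | some s =>
      simp only [hl, Option.map_some] at h
      obtain rfl := Option.some_injective _ h
      exact .recv s j m hl hm

/-- The message tells the truth: it carries the neighbourhood of its origin and the state of its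
origin in the preceding phase. -/
structure LWAMsg.Truthful (G : Digraph V) (vals : V → List ℝ) (m : LWAMsg V) : Prop where
  -- Keeps the subtraction in `value` from being truncated.
  phase_pos : 1 ≤ m.phase
  nbrs : m.nbrs = inNbrs G m.origin
  value : (vals m.origin)[m.phase - 1]? = some m.value

theorem LWAMsg.Truthful.mono {vals vals' : V → List ℝ} {m : LWAMsg V} (h : m.Truthful G vals)
    (hv : ∀ i, vals i <+: vals' i) : m.Truthful G vals' :=
  ⟨h.phase_pos, h.nbrs, getElem?_of_prefix (hv _) h.value⟩

/-- The invariant of the local state `s` of node `i`. -/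
structure LWAState.Inv (G : Digraph V) (vals : V → List ℝ) (i : V) (s : LWAState V) : Prop where
  self : s.self = i
  inN : s.inN = inNbrs G i
  outN : s.outN = outNbrs G i
  -- In phase `p` exactly the `p` states of the phases `0, …, p - 1` have been computed.
  phase : s.phase = (vals i).length
  phase_pos : 1 ≤ s.phase
  own : ∀ q, 1 ≤ q → q ≤ s.phase → ∃ m ∈ s.handled, m.origin = i ∧ m.phase = q
  handled : ∀ m ∈ s.handled, m.Truthful G vals
  inbox : ∀ m ∈ s.inbox, m.Truthful G vals
  -- Supplies the in-neighbour from which `CCA.lt_card_inNbrs` obtains more than `f` of them.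
  inbox_nbr : s.inbox ≠ [] → ∃ j, G.Adj j i

theorem LWAState.Inv.mono {vals vals' : V → List ℝ} {i : V} {s : LWAState V}
    (h : s.Inv G vals i) (hv : ∀ i, vals i <+: vals' i) (hi : vals' i = vals i) :
    s.Inv G vals' i :=
  { h with
    phase := by rw [hi]; exact h.phase
    handled := fun m hm => (h.handled m hm).mono hv
    inbox := fun m hm => (h.inbox m hm).mono hv }

/-- The invariant of the configurations of LWA. -/
structure LWAInv (G : Digraph V) (c : Config (LWA (V := V) f)) : Prop where
  idle : ∀ i, c.loc i = none → c.vals i = []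
  node : ∀ i (s : LWAState V), c.loc i = some s → s.Inv G c.vals i
  chan : ∀ j k (m : LWAMsg V), m ∈ c.chan j k → G.Adj j k ∧ m.Truthful G c.vals

theorem LWAState.Inv.enter {vals vals' : V → List ℝ} {i : V} {s : LWAState V} {v : ℝ}
    (h : s.Inv G vals i) (hv : ∀ i, vals i <+: vals' i) (hi : vals' i = vals i ++ [v]) :
    (s.enter (s.phase + 1) v).Inv G vals' i ∧
      (s.ownMsg (s.phase + 1) v).Truthful G vals' := by
  have ht : (s.ownMsg (s.phase + 1) v).Truthful G vals' := by
    refine ⟨by simp [LWAState.ownMsg], by simp [LWAState.ownMsg, h.inN, h.self], ?_⟩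
    simp only [LWAState.ownMsg, h.self, hi, Nat.add_sub_cancel, h.phase]
    simp
  refine ⟨⟨h.self, h.inN, h.outN, ?_, by simp [LWAState.enter], fun q hq hq' => ?_,
    fun m hm => ?_, fun m hm => (h.inbox m hm).mono hv, h.inbox_nbr⟩, ht⟩
  · simp [LWAState.enter, hi, h.phase]
  · rcases Nat.lt_or_ge s.phase q with hlt | hle
    · refine ⟨_, LWAState.mem_enter_handled.2 (Or.inl rfl), h.self, ?_⟩
      simp only [LWAState.enter] at hq'
      simp only [LWAState.ownMsg]
      omega
    · obtain ⟨m, hm, h1, h2⟩ := h.own q hq hle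
      exact ⟨m, LWAState.mem_enter_handled.2 (Or.inr hm), h1, h2⟩
  · rcases LWAState.mem_enter_handled.1 hm with rfl | hm
    exacts [ht, (h.handled m hm).mono hv]

theorem LWAMove.inv {c : Config (LWA (V := V) f)} {i : V} {τ : Trigger (LWA (V := V) f)}
    {a : Action V (LWAState V) (LWAMsg V)} (h : LWAMove G x c i τ a) (hc : LWAInv G c)
    {vals' : V → List ℝ} (hv : ∀ k, c.vals k <+: vals' k)
    (hi : vals' i = c.vals i ++ a.commit.toList) :
    a.next.Inv G vals' i ∧ ∀ k, ∀ m ∈ a.send k, m.Truthful G vals' := by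
  cases h with
  | start s hs h =>
    subst hs
    rw [hc.idle i h] at hi
    have ht : (⟨x i, inNbrs G i, i, 1⟩ : LWAMsg V).Truthful G vals' :=
      ⟨le_rfl, rfl, by simp [hi]⟩
    refine ⟨⟨rfl, rfl, rfl, by simp [LWAState.enter, hi], le_rfl, fun q hq hq' => ?_,
      fun m hm => ?_, fun m hm => by simp [LWAState.enter] at hm,
      fun h => (h rfl).elim⟩, fun k m hm => ?_⟩
    · refine ⟨_, LWAState.mem_enter_handled.2 (Or.inl rfl), rfl, ?_⟩
      simp only [LWAState.enter] at hq'
      simp only [LWAState.ownMsg]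
      omega
    · rcases LWAState.mem_enter_handled.1 hm with rfl | hm
      exacts [ht, by simp at hm]
    · obtain ⟨-, rfl⟩ := LWAState.mem_broadcast.1 hm
      exact ht
  | commit s h hw =>
    obtain ⟨h1, h2⟩ := (hc.node i s h).enter hv hi
    refine ⟨h1, fun k m hm => ?_⟩
    obtain ⟨-, rfl⟩ := LWAState.mem_broadcast.1 hm
    exact h2
  | skip s h hw hin =>
    exact ⟨(hc.node i s h).mono hv (by simpa using hi), by simp⟩
  | duplicate s m rest h hw hin hm =>
    have hs := (hc.node i s h).mono hv (by simpa using hi)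
    exact ⟨{ hs with
      inbox := fun m' hm' => hs.inbox m' (by rw [hin]; exact List.mem_cons_of_mem _ hm')
      inbox_nbr := fun _ => hs.inbox_nbr (by simp [hin]) }, by simp⟩
  | handle s m rest handled h hw hin hm hh =>
    have hs := (hc.node i s h).mono hv (by simpa using hi)
    have hmt : m.Truthful G vals' := hs.inbox m (by simp [hin])
    refine ⟨{ hs with
      own := fun q hq hq' => ?_
      handled := fun m' hm' => ?_
      inbox := fun m' hm' => hs.inbox m' (by rw [hin]; exact List.mem_cons_of_mem _ hm')
      inbox_nbr := fun _ => hs.inbox_nbr (by simp [hin]) }, fun k m' hm' => ?_⟩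
    · obtain ⟨m', h1, h2⟩ := hs.own q hq hq'
      exact ⟨m', (hh m').2 (Or.inr h1), h2⟩
    · rcases (hh m').1 hm' with rfl | hm'
      exacts [hmt, hs.handled m' hm']
    · obtain ⟨-, rfl⟩ := LWAState.mem_broadcast.1 hm'
      exact hmt
  | recv s j m h hm =>
    have hs := (hc.node i s h).mono hv (by simpa using hi)
    refine ⟨{ hs with
      inbox := fun m' hm' => ?_
      inbox_nbr := fun _ => ⟨j, (hc.chan j i m hm).1⟩ }, by simp⟩
    rcases List.mem_append.1 hm' with hm' | hm'
    · exact hs.inbox m' hm'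
    · rw [List.mem_singleton.1 hm']
      exact (hc.chan j i m hm).2.mono hv

theorem Run.lwaInv (r : Run (LWA (V := V) f) G x) (t : ℕ) : LWAInv G (r.cfg t) := by
  induction t with
  | zero =>
    rw [r.init]
    refine ⟨fun _ _ => rfl, fun i s h => ?_, fun j k m hm => ?_⟩
    · simp [Config.initial] at h
    · exact absurd hm (Multiset.notMem_zero m)
  | succ t ih =>
    have hv := (r.step t).vals_prefix
    rcases (r.step t).idle_or_performs with ⟨h1, h2, h3, -⟩ | ⟨k, τ, a, sent, h⟩
    · exact ⟨by rw [h1, h2]; exact ih.idle, by rw [h1, h2]; exact ih.node,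
        by rw [h2, h3]; exact ih.chan⟩
    · obtain ⟨h1, h2⟩ := (LWAMove.of_response h.resp).inv ih hv h.vals_self
      refine ⟨fun i hi => ?_, fun i s hi => ?_, fun j k' m hm => ?_⟩
      · by_cases hik : i = k
        · subst hik; simp [h.loc_self] at hi
        · rw [h.loc_of_ne hik] at hi
          rw [h.vals_of_ne hik]
          exact ih.idle i hi
      · by_cases hik : i = k
        · subst hik
          rw [h.loc_self] at hi
          obtain rfl := Option.some_injective _ hi
          exact h1
        · rw [h.loc_of_ne hik] at hi
          exact (ih.node i s hi).mono hv (h.vals_of_ne hik)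
      · rcases h.mem_chan hm with hm | ⟨rfl, hadj, hm⟩
        · exact ⟨(ih.chan j k' m hm).1, (ih.chan j k' m hm).2.mono hv⟩
        · exact ⟨hadj, h2 k' m hm⟩

/-! ### Flooding of messages -/

/-- Node `i` has handled the message `m`. -/
def Config.Handled (c : Config (LWA (V := V) f)) (i : V) (m : LWAMsg V) : Prop :=
  ∃ s : LWAState V, c.loc i = some s ∧ m ∈ s.handled

/-- The message `m` has arrived at node `i`. -/
def Config.Arrived (c : Config (LWA (V := V) f)) (i : V) (m : LWAMsg V) : Prop :=
  ∃ s : LWAState V, c.loc i = some s ∧ (m ∈ s.inbox ∨ m ∈ s.handled)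

theorem LWAMove.handled_subset {c : Config (LWA (V := V) f)} {i : V}
    {τ : Trigger (LWA (V := V) f)} {a : Action V (LWAState V) (LWAMsg V)}
    (h : LWAMove G x c i τ a) {s : LWAState V} (hs : c.loc i = some s) :
    s.handled ⊆ a.next.handled := by
  cases h with
  | start _ _ h => rw [hs] at h; simp at h
  | commit _ h =>
    rw [hs] at h; obtain rfl := Option.some_injective _ h
    exact fun m hm => LWAState.mem_enter_handled.2 (Or.inr hm)
  | skip _ h => rw [hs] at h; obtain rfl := Option.some_injective _ h; exact subset_rfl
  | duplicate _ _ _ h => rw [hs] at h; obtain rfl := Option.some_injective _ h; exact subset_rfl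
  | handle _ _ _ _ h _ _ _ hh =>
    rw [hs] at h; obtain rfl := Option.some_injective _ h
    exact fun m hm => (hh m).2 (Or.inr hm)
  | recv _ _ _ h => rw [hs] at h; obtain rfl := Option.some_injective _ h; exact subset_rfl

theorem LWAMove.arrived {c : Config (LWA (V := V) f)} {i : V}
    {τ : Trigger (LWA (V := V) f)} {a : Action V (LWAState V) (LWAMsg V)}
    (h : LWAMove G x c i τ a) {m : LWAMsg V} (hm : c.Arrived i m) :
    m ∈ a.next.inbox ∨ m ∈ a.next.handled := by
  obtain ⟨s, hs, hm⟩ := hm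
  rcases hm with hm | hm
  · cases h with
    | start _ _ h => rw [hs] at h; simp at h
    | commit _ h => rw [hs] at h; obtain rfl := Option.some_injective _ h; exact Or.inl hm
    | skip _ h => rw [hs] at h; obtain rfl := Option.some_injective _ h; exact Or.inl hm
    | duplicate _ m' rest h _ hin hm' =>
      rw [hs] at h; obtain rfl := Option.some_injective _ h
      rw [hin] at hm
      rcases List.mem_cons.1 hm with rfl | hm
      exacts [Or.inr hm', Or.inl hm]
    | handle _ m' rest _ h _ hin _ hh =>
      rw [hs] at h; obtain rfl := Option.some_injective _ h
      rw [hin] at hm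
      rcases List.mem_cons.1 hm with rfl | hm
      exacts [Or.inr ((hh m).2 (Or.inl rfl)), Or.inl hm]
    | recv _ _ _ h =>
      rw [hs] at h; obtain rfl := Option.some_injective _ h
      exact Or.inl (List.mem_append_left _ hm)
  · exact Or.inr (h.handled_subset hs hm)

/-- A message enters the handled set only in a move that also broadcasts it, whether it is the
node's own or a relayed one. -/
theorem LWAMove.sent_of_handled {c : Config (LWA (V := V) f)} {i : V}
    {τ : Trigger (LWA (V := V) f)} {a : Action V (LWAState V) (LWAMsg V)}
    (h : LWAMove G x c i τ a) (hc : LWAInv G c) {m : LWAMsg V} (hm : m ∈ a.next.handled) :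
    c.Handled i m ∨ ∀ k, G.Adj i k → m ∈ a.send k := by
  have hout : ∀ k, G.Adj i k → k ∈ outNbrs G i := fun k hk => by simp [outNbrs, hk]
  cases h with
  | start s hsd h =>
    subst hsd
    rcases LWAState.mem_enter_handled.1 hm with rfl | hm
    · exact Or.inr fun k hk => LWAState.mem_broadcast.2 ⟨hout k hk, rfl⟩
    · simp at hm
  | commit s h =>
    rcases LWAState.mem_enter_handled.1 hm with rfl | hm
    · exact Or.inr fun k hk =>
        LWAState.mem_broadcast.2 ⟨by rw [(hc.node i s h).outN]; exact hout k hk, rfl⟩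
    · exact Or.inl ⟨s, h, hm⟩
  | skip s h => exact Or.inl ⟨s, h, hm⟩
  | duplicate s _ _ h => exact Or.inl ⟨s, h, hm⟩
  | handle s m' rest _ h _ hin _ hh =>
    rcases (hh m).1 hm with rfl | hm
    · exact Or.inr fun k hk =>
        LWAState.mem_broadcast.2 ⟨by rw [(hc.node i s h).outN]; exact hout k hk, rfl⟩
    · exact Or.inl ⟨s, h, hm⟩
  | recv s _ _ h => exact Or.inl ⟨s, h, hm⟩

theorem Run.arrived_succ (r : Run (LWA (V := V) f) G x) {t : ℕ} {i : V} {m : LWAMsg V}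
    (h : (r.cfg t).Arrived i m) : (r.cfg (t + 1)).Arrived i m := by
  rcases (r.step t).idle_or_performs with ⟨h1, -, -, -⟩ | ⟨k, τ, a, sent, hp⟩
  · unfold Config.Arrived; rwa [h1]
  · by_cases hik : i = k
    · subst hik
      exact ⟨a.next, hp.loc_self, (LWAMove.of_response hp.resp).arrived h⟩
    · unfold Config.Arrived; rwa [hp.loc_of_ne hik]

theorem Run.handled_mono (r : Run (LWA (V := V) f) G x) {s t : ℕ} (hst : s ≤ t) {i : V}
    {m : LWAMsg V} (h : (r.cfg s).Handled i m) : (r.cfg t).Handled i m := by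
  induction t, hst using Nat.le_induction with
  | base => exact h
  | succ t _ ih =>
    rcases (r.step t).idle_or_performs with ⟨h1, -, -, -⟩ | ⟨k, τ, a, sent, hp⟩
    · unfold Config.Handled; rwa [h1]
    · by_cases hik : i = k
      · subst hik
        obtain ⟨s, hs, hm⟩ := ih
        exact ⟨a.next, hp.loc_self, (LWAMove.of_response hp.resp).handled_subset hs hm⟩
      · unfold Config.Handled; rwa [hp.loc_of_ne hik]

/-- What a node has handled is on the way to its outgoing neighbours, or has arrived there. -/
theorem Run.relayed (r : Run (LWA (V := V) f) G x) (t : ℕ) {j k : V}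
    (hj : j ∉ (r.cfg t).crashed) (hjk : G.Adj j k) {m : LWAMsg V}
    (hm : (r.cfg t).Handled j m) : m ∈ (r.cfg t).chan j k ∨ (r.cfg t).Arrived k m := by
  induction t with
  | zero =>
    obtain ⟨s, hs, -⟩ := hm
    rw [r.init] at hs
    simp [Config.initial] at hs
  | succ t ih =>
    have hj' := fun h => hj ((r.step t).crashed_subset h)
    have hold : (r.cfg t).Handled j m →
        m ∈ (r.cfg (t + 1)).chan j k ∨ (r.cfg (t + 1)).Arrived k m := by
      intro hm
      rcases ih hj' hm with h | h
      · rcases (r.step t).idle_or_performs with ⟨-, -, h3, -⟩ | ⟨i, τ, a, sent, hp⟩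
        · exact Or.inl (by rwa [h3])
        · rcases hp.mem_chan_of_mem h with h | ⟨rfl, rfl⟩
          · exact Or.inl h
          · refine Or.inr ⟨a.next, hp.loc_self, Or.inl ?_⟩
            cases LWAMove.of_response hp.resp with
            | recv => exact List.mem_append_right _ (by simp)
      · exact Or.inr (r.arrived_succ h)
    rcases (r.step t).idle_or_performs with ⟨h1, -, -, -⟩ | ⟨i, τ, a, sent, hp⟩
    · refine hold ?_
      unfold Config.Handled at hm ⊢
      rwa [h1] at hm
    · by_cases hji : j = i
      · subst hji
        obtain ⟨s, hs, hms⟩ := hm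
        rw [hp.loc_self] at hs
        obtain rfl := Option.some_injective _ hs
        rcases (LWAMove.of_response hp.resp).sent_of_handled (r.lwaInv t) hms with h | h
        · exact hold h
        · exact Or.inl (hp.mem_chan_of_send hj hjk (h k hjk))
      · refine hold ?_
        unfold Config.Handled at hm ⊢
        rwa [hp.loc_of_ne hji] at hm

end LWAInvariants

/-! ### Correctness of LWA: agreement -/

section Agreement

variable {V : Type u} [Fintype V] {f : ℕ} {G : Digraph V} {x : V → ℝ}

theorem Run.HasState.exists_commit {r : Run (LWA (V := V) f) G x} {i : V} {p : ℕ} {y : ℝ}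
    (h : r.HasState i p y) (hp : 1 ≤ p) :
    ∃ t, ∃ s : LWAState V, r.ComputesAt i p t ∧ (r.cfg t).loc i = some s ∧ s.phase = p ∧
      s.Wait f ∧ y = s.average := by
  obtain ⟨t, ht, hv⟩ := h.exists_computesAt
  rcases (r.step t).idle_or_performs with ⟨-, h2, -, -⟩ | ⟨k, τ, a, sent, hp'⟩
  · rw [h2] at hv; simp at hv
  · by_cases hik : i = k
    · subst hik
      rw [hp'.vals_self, List.append_cancel_left_eq] at hv
      have hinv := r.lwaInv t
      cases LWAMove.of_response hp'.resp with
      | start s hs h =>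
        have := ht.1
        rw [hinv.idle i h] at this
        simp at this
        omega
      | commit s h hw =>
        refine ⟨t, s, ht, h, (hinv.node i s h).phase.trans ht.1, hw, ?_⟩
        simpa using hv.symm
      | skip => simp at hv
      | duplicate => simp at hv
      | handle => simp at hv
      | recv => simp at hv
    · rw [hp'.vals_of_ne hik] at hv; simp at hv

/-- The set that a node reaches when Condition `n`-WAIT holds has few incoming neighbours. -/
theorem LWAState.Inv.exists_closed {vals : V → List ℝ} {i : V} {s : LWAState V}
    (h : s.Inv G vals i) (hw : s.Wait f) :
    ∃ L : Set V, i ∈ L ∧ L ⊆ s.heard s.phase ∧ (inNbrsOfSet G Set.univ L).ncard ≤ f := by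
  classical
  obtain ⟨S, hS, hcard, hsub⟩ := hw
  rw [h.self] at hS hsub
  refine ⟨_, ?_, hsub, ?_⟩
  · obtain ⟨m, hm, h1, h2⟩ := h.own s.phase h.phase_pos le_rfl
    exact ⟨⟨m, hm, h2, Or.inr h1.symm⟩, fun hi => (hS i hi).2 rfl, .refl⟩
  · rw [← Set.ncard_coe_finset] at hcard
    refine (Set.ncard_le_ncard ?_ (Set.toFinite _)).trans hcard
    rintro a ⟨-, ha, b, hb, hab⟩
    -- `b` has been heard, so its message lists `a` as an in-neighbour. If `a ∉ S`, the edge from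
    -- `a` to `b` extends the path from `b`, and `a` would belong to the set itself.
    by_contra haS
    obtain ⟨m, hm, hmp, rfl⟩ := hsub hb
    have ham : a ∈ m.nbrs := by
      rw [(h.handled m hm).nbrs]
      simpa [inNbrs] using hab
    have hav : a ∈ (s.est s.phase).verts := ⟨m, hm, hmp, Or.inl ham⟩
    exact ha ⟨hav, haS, .head ⟨⟨m, hm, hmp, ham, rfl⟩, ⟨hav, haS⟩, hb.1, hb.2.1⟩ hb.2.2⟩

/-- If the sets were disjoint, CCA with `C` the complement of their union would give one of them `f
+ 1` incoming neighbours. -/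
theorem CCA.inter_nonempty (h : CCA G f) {L R : Set V} (hL : L.Nonempty) (hR : R.Nonempty)
    (hLf : (inNbrsOfSet G Set.univ L).ncard ≤ f) (hRf : (inNbrsOfSet G Set.univ R).ncard ≤ f) :
    (L ∩ R).Nonempty := by
  by_contra hne
  have hdis : Disjoint L R := Set.disjoint_iff_inter_eq_empty.2 (Set.not_nonempty_iff_eq_empty.1 hne)
  have hmono : ∀ A B : Set V, (inNbrsOfSet G A B).ncard ≤ (inNbrsOfSet G Set.univ B).ncard :=
    fun A B => Set.ncard_le_ncard (fun a ha => ⟨trivial, ha.2⟩) (Set.toFinite _)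
  rcases h L (L ∪ R)ᶜ R (Set.disjoint_left.2 fun a ha h => h (Or.inl ha)) hdis
    (Set.disjoint_left.2 fun a h ha => h (Or.inr ha))
    (Set.eq_univ_of_forall fun a => by
      by_cases h1 : a ∈ L <;> by_cases h2 : a ∈ R <;> simp [h1, h2]) hL hR with h | h
  · exact absurd (h.trans ((hmono _ _).trans hRf)) (by omega)
  · exact absurd (h.trans ((hmono _ _).trans hLf)) (by omega)

theorem CCA.exists_common_heard (h : CCA G f) {vals vals' : V → List ℝ} {i j : V}
    {s s' : LWAState V} (hs : s.Inv G vals i) (hs' : s'.Inv G vals' j) (hw : s.Wait f)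
    (hw' : s'.Wait f) : (s.heard s.phase ∩ s'.heard s'.phase).Nonempty := by
  obtain ⟨L, hi, hL, hLf⟩ := hs.exists_closed hw
  obtain ⟨R, hj, hR, hRf⟩ := hs'.exists_closed hw'
  exact (h.inter_nonempty ⟨i, hi⟩ ⟨j, hj⟩ hLf hRf).mono (Set.inter_subset_inter hL hR)

theorem CCA.heardStar_inter_nonempty (h : CCA G f) (r : Run (LWA (V := V) f) G x) {p : ℕ}
    (hp : 1 ≤ p) {i j : V} (hi : i ∉ r.F p) (hj : j ∉ r.F p) :
    (heardStar r i p ∩ heardStar r j p).Nonempty := by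
  simp only [Run.F, Set.mem_ofPred_eq, not_forall, not_not] at hi hj
  obtain ⟨y, hy⟩ := hi
  obtain ⟨z, hz⟩ := hj
  obtain ⟨t, s, ht, hs, hsp, hsw, -⟩ := hy.exists_commit hp
  obtain ⟨t', s', ht', hs', hsp', hsw', -⟩ := hz.exists_commit hp
  obtain ⟨k, hk, hk'⟩ := h.exists_common_heard ((r.lwaInv t).node i s hs)
    ((r.lwaInv t').node j s' hs') hsw hsw'
  rw [hsp] at hk
  rw [hsp'] at hk'
  exact ⟨k, ⟨t, s, ht, hs, hk⟩, ⟨t', s', ht', hs', hk'⟩⟩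

/-! ### Averaging, Validity and contraction -/

/-- No term exceeds `b`, and the term at `m₀` alone lowers the average by at least `(b - g m₀) /
T.card`. Passing to `n` makes the bound independent of how many values were averaged. -/
theorem sum_div_card_le {ι : Type*} {T : Finset ι} {g : ι → ℝ} {b : ℝ} {n : ℕ}
    (hg : ∀ m ∈ T, g m ≤ b) (hn : T.card ≤ n) {m₀ : ι} (hm₀ : m₀ ∈ T) :
    (∑ m ∈ T, g m) / T.card ≤ b - (b - g m₀) / n := by
  have hcard : (0 : ℝ) < T.card := by exact_mod_cast Finset.card_pos.2 ⟨m₀, hm₀⟩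
  have hle : (T.card : ℝ) ≤ n := by exact_mod_cast hn
  have h1 : b - g m₀ ≤ ∑ m ∈ T, (b - g m) :=
    Finset.single_le_sum (f := fun m => b - g m) (fun m hm => sub_nonneg.2 (hg m hm)) hm₀
  rw [Finset.sum_sub_distrib, Finset.sum_const, nsmul_eq_mul] at h1
  have h2 : (b - g m₀) / n ≤ (b - g m₀) / T.card :=
    div_le_div_of_nonneg_left (sub_nonneg.2 (hg m₀ hm₀)) hcard hle
  have h3 : (∑ m ∈ T, g m) / T.card ≤ b - (b - g m₀) / T.card := by
    rw [div_le_iff₀ hcard, sub_mul, div_mul_cancel₀ _ hcard.ne']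
    linarith
  linarith

theorem le_sum_div_card {ι : Type*} {T : Finset ι} {g : ι → ℝ} {b : ℝ} {n : ℕ}
    (hg : ∀ m ∈ T, b ≤ g m) (hn : T.card ≤ n) {m₀ : ι} (hm₀ : m₀ ∈ T) :
    b + (g m₀ - b) / n ≤ (∑ m ∈ T, g m) / T.card := by
  have h := sum_div_card_le (g := fun m => - g m) (b := -b)
    (fun m hm => neg_le_neg (hg m hm)) hn hm₀
  rw [Finset.sum_neg_distrib, neg_div] at h
  have h2 : (-b - -g m₀) / (n : ℝ) = (g m₀ - b) / n := by ring
  rw [h2] at h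
  linarith

open Classical in
/-- A node computes the average of the states of at most `n` nodes, one for each of the nodes
that it has heard from. -/
theorem Run.average_eq (r : Run (LWA (V := V) f) G x) {t : ℕ} {i : V} {s : LWAState V}
    (hs : (r.cfg t).loc i = some s) :
    ∃ T : Finset (LWAMsg V), s.average = (∑ m ∈ T, m.value) / T.card ∧
      T.card ≤ Fintype.card V ∧ T.Nonempty ∧
      (∀ m ∈ T, r.HasState m.origin (s.phase - 1) m.value) ∧
      ∀ k ∈ s.heard s.phase, ∃ m ∈ T, m.origin = k := by
  have hinv := (r.lwaInv t).node i s hs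
  refine ⟨s.handled.filter fun m => m.phase = s.phase, ?_, ?_, ?_, ?_, ?_⟩
  · unfold LWAState.average LWAState.R
    rw [Multiset.card_map, Finset.card_val]
    rfl
  -- A truthful message is determined by its origin and phase, so there is at most one per node.
  · refine Finset.card_le_card_of_injOn (t := Finset.univ) LWAMsg.origin (by simp) ?_
    intro m hm m' hm' heq
    simp only [Finset.coe_filter, Set.mem_ofPred_eq] at hm hm'
    have h1 := hinv.handled m hm.1
    have h2 := hinv.handled m' hm'.1
    have hp : m.phase = m'.phase := hm.2.trans hm'.2.symm
    have hn : m.nbrs = m'.nbrs := by rw [h1.nbrs, h2.nbrs, heq]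
    have hv : m.value = m'.value := by
      have hv1 := h1.value
      have hv2 := h2.value
      rw [heq, hp, hv2] at hv1
      exact (Option.some_injective _ hv1).symm
    cases m; cases m'; simp_all
  · obtain ⟨m, hm, -, h2⟩ := hinv.own s.phase hinv.phase_pos le_rfl
    exact ⟨m, Finset.mem_filter.2 ⟨hm, h2⟩⟩
  · intro m hm
    obtain ⟨hm, hmp⟩ := Finset.mem_filter.1 hm
    exact ⟨t, hmp ▸ (hinv.handled m hm).value⟩
  · rintro k ⟨m, hm, hmp, hk⟩
    exact ⟨m, Finset.mem_filter.2 ⟨hm, hmp⟩, hk⟩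

theorem Run.HasState.mem_Icc {r : Run (LWA (V := V) f) G x} {i : V} {p : ℕ} {y : ℝ}
    (h : r.HasState i p y) : r.mu 0 ≤ y ∧ y ≤ r.U 0 := by
  induction p generalizing i y with
  | zero => exact ⟨mu_le h, le_U h⟩
  | succ p ih =>
    obtain ⟨t, s, -, hs, hsp, -, rfl⟩ := h.exists_commit (Nat.succ_pos p)
    obtain ⟨T, hT, hcard, ⟨m₀, hm₀⟩, hst, -⟩ := r.average_eq hs
    rw [hsp, Nat.add_sub_cancel] at hst
    have h1 := sum_div_card_le (fun m hm => (ih (hst m hm)).2) le_rfl hm₀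
    have h2 := le_sum_div_card (fun m hm => (ih (hst m hm)).1) le_rfl hm₀
    have h3 : 0 ≤ (r.U 0 - m₀.value) / (T.card : ℝ) :=
      div_nonneg (sub_nonneg.2 (ih (hst m₀ hm₀)).2) (Nat.cast_nonneg _)
    have h4 : 0 ≤ (m₀.value - r.mu 0) / (T.card : ℝ) :=
      div_nonneg (sub_nonneg.2 (ih (hst m₀ hm₀)).1) (Nat.cast_nonneg _)
    rw [hT]
    constructor <;> linarith

theorem Run.lwa_validity (r : Run (LWA (V := V) f) G x) : r.Validity := by
  intro p _ hne
  refine ⟨csSup_le hne ?_, le_csInf hne ?_⟩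
  · rintro y ⟨i, hi⟩
    exact hi.mem_Icc.2
  · rintro y ⟨i, hi⟩
    exact hi.mem_Icc.1

theorem Run.U_sub_mu_le {P : Protocol V} (r : Run P G x) {p : ℕ} {D : ℝ} (hD : 0 ≤ D)
    (h : ∀ y ∈ r.states p, ∀ z ∈ r.states p, y - z ≤ D) : r.U p - r.mu p ≤ D := by
  rcases (r.states p).eq_empty_or_nonempty with he | hne
  -- In `ℝ`, `sSup ∅ = sInf ∅ = 0`; the hypothesis `0 ≤ D` covers this case.
  · simpa [Run.U, Run.mu, he] using hD
  · have h1 : r.U p - D ≤ r.mu p := le_csInf hne fun z hz => by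
      have : r.U p ≤ z + D := csSup_le hne fun y hy => by linarith [h y hy z hz]
      linarith
    linarith

theorem Run.U_sub_mu_nonneg {P : Protocol V} (r : Run P G x) (p : ℕ) :
    0 ≤ r.U p - r.mu p := by
  rcases (r.states p).eq_empty_or_nonempty with he | ⟨y, i, hy⟩
  · simp [Run.U, Run.mu, he]
  · linarith [mu_le hy, le_U hy]

/-- States of phase `0` are inputs. The crude bound matters because it does not mention the run. -/
theorem Run.U_sub_mu_zero_le {P : Protocol V} (r : Run P G x) :
    r.U 0 - r.mu 0 ≤ 2 * ∑ i, |x i| := by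
  have hle : ∀ i, |x i| ≤ ∑ i, |x i| := fun i =>
    Finset.single_le_sum (f := fun i => |x i|) (fun _ _ => abs_nonneg _) (Finset.mem_univ i)
  refine r.U_sub_mu_le (mul_nonneg zero_le_two (Finset.sum_nonneg fun _ _ => abs_nonneg _)) ?_
  rintro y ⟨i, hi⟩ z ⟨j, hj⟩
  rw [hi.zero, hj.zero]
  linarith [hle i, hle j, le_abs_self (x i), neg_abs_le (x j)]

/-- Each phase of LWA brings the states closer to each other. -/
theorem CCA.U_sub_mu_succ_le (h : CCA G f) (r : Run (LWA (V := V) f) G x) (p : ℕ) :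
    r.U (p + 1) - r.mu (p + 1) ≤ (1 - 1 / (Fintype.card V : ℝ)) * (r.U p - r.mu p) := by
  set n := Fintype.card V
  have hn : 1 / (n : ℝ) ≤ 1 := by simpa using Nat.cast_inv_le_one (α := ℝ) n
  refine r.U_sub_mu_le (mul_nonneg (sub_nonneg.2 hn) (r.U_sub_mu_nonneg p)) ?_
  rintro y ⟨i, hi⟩ z ⟨j, hj⟩
  obtain ⟨t, s, -, hs, hsp, hw, rfl⟩ := hi.exists_commit (Nat.succ_pos p)
  obtain ⟨t', s', -, hs', hsp', hw', rfl⟩ := hj.exists_commit (Nat.succ_pos p)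
  obtain ⟨k, hk, hk'⟩ := h.exists_common_heard ((r.lwaInv t).node i s hs)
    ((r.lwaInv t').node j s' hs') hw hw'
  obtain ⟨T, hT, hcard, -, hst, hT2⟩ := r.average_eq hs
  obtain ⟨T', hT', hcard', -, hst', hT2'⟩ := r.average_eq hs'
  rw [hsp, Nat.add_sub_cancel] at hst
  rw [hsp', Nat.add_sub_cancel] at hst'
  obtain ⟨m, hm, rfl⟩ := hT2 k hk
  obtain ⟨m', hm', hmm⟩ := hT2' _ hk'
  have hv : m'.value = m.value := by
    have := hst' m' hm'
    rw [hmm] at this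
    exact this.unique (hst m hm)
  -- The common value `w` keeps one average at least `(U - w)/n` below `U` and the other at least
  -- `(w - μ)/n` above `μ`; in the difference `w` cancels.
  have h1 := sum_div_card_le (fun m hm => Run.le_U (hst m hm)) hcard hm
  have h2 := le_sum_div_card (fun m hm => Run.mu_le (hst' m hm)) hcard' hm'
  rw [hv] at h2
  rw [hT, hT']
  have h3 : (1 - 1 / (n : ℝ)) * (r.U p - r.mu p) =
      (r.U p - (r.U p - m.value) / n) - (r.mu p + (m.value - r.mu p) / n) := by ring
  rw [h3]
  linarith

theorem CCA.U_sub_mu_le_pow (h : CCA G f) (r : Run (LWA (V := V) f) G x) (p : ℕ) :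
    r.U p - r.mu p ≤ (1 - 1 / (Fintype.card V : ℝ)) ^ p * (2 * ∑ i, |x i|) := by
  induction p with
  | zero => simpa using r.U_sub_mu_zero_le
  | succ p ih =>
    refine (h.U_sub_mu_succ_le r p).trans ?_
    rw [pow_succ', mul_assoc]
    exact mul_le_mul_of_nonneg_left ih (sub_nonneg.2 (by simpa using Nat.cast_inv_le_one (α := ℝ) (Fintype.card V)))

theorem tendsto_one_sub_inv_card_pow_mul [Nonempty V] (K : ℝ) :
    Filter.Tendsto (fun p : ℕ => (1 - 1 / (Fintype.card V : ℝ)) ^ p * K) Filter.atTop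
      (nhds 0) := by
  have hn : (0 : ℝ) < 1 / (Fintype.card V : ℝ) :=
    one_div_pos.2 (by exact_mod_cast Fintype.card_pos)
  have h := (tendsto_pow_atTop_nhds_zero_of_lt_one (r := 1 - 1 / (Fintype.card V : ℝ))
    (sub_nonneg.2 (by simpa using Nat.cast_inv_le_one (α := ℝ) (Fintype.card V))) (by linarith)).mul_const K
  rwa [zero_mul] at h

theorem CCA.convergence [Nonempty V] (h : CCA G f) (r : Run (LWA (V := V) f) G x) :
    r.Convergence :=
  squeeze_zero r.U_sub_mu_nonneg (h.U_sub_mu_le_pow r) (tendsto_one_sub_inv_card_pow_mul _)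

end Agreement

/-! ### Correctness of LWA: progress -/

section Progress

variable {V : Type u} [Fintype V] {f : ℕ} {G : Digraph V} {x : V → ℝ}

theorem Run.performs_of_act {P : Protocol V} (r : Run P G x) {t : ℕ} {i : V} {τ : Trigger P}
    (h : r.ev t = .act i τ) :
    ∃ a sent, Performs G x (r.cfg t) (r.cfg (t + 1)) i τ a sent := by
  have hs := r.step t
  rw [h] at hs
  generalize r.cfg (t + 1) = c' at hs ⊢
  cases hs with
  | act _ _ a hi ha =>
    exact ⟨a, a.send, hi, ha, fun _ => le_rfl, fun _ => rfl, subset_rfl, rfl, rfl, rfl⟩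

/-- Apply CCA to `{i}`, `∅` and the rest. Either `i` has `f + 1` in-neighbours, or the single node
`i` supplies `f + 1` of them for the rest; then `f = 0` and the in-neighbour `j` suffices. -/
theorem CCA.lt_card_inNbrs (h : CCA G f) (hG : ∀ i, ¬ G.Adj i i) {i j : V}
    (hij : G.Adj j i) : f < (inNbrs G i).card := by
  classical
  have hji : j ≠ i := by rintro rfl; exact hG _ hij
  rcases h {i} ∅ {i}ᶜ (by simp) (by simp) (by simp) (by simp) ⟨i, rfl⟩ ⟨j, hji⟩ with h | h
  · have h1 : (inNbrsOfSet G ({i} ∪ ∅) {i}ᶜ).ncard ≤ 1 := by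
      rw [← Set.ncard_singleton i]
      refine Set.ncard_le_ncard ?_ (Set.toFinite _)
      rintro a ⟨ha, -⟩
      simpa using ha
    have h2 : 0 < (inNbrs G i).card := Finset.card_pos.2 ⟨j, by simpa [inNbrs] using hij⟩
    have h3 : f + 1 ≤ 1 := h.trans h1
    omega
  · have h1 : (inNbrsOfSet G ({i}ᶜ ∪ ∅) {i}).ncard ≤ (inNbrs G i).card := by
      rw [← Set.ncard_coe_finset]
      refine Set.ncard_le_ncard ?_ (Set.toFinite _)
      rintro a ⟨-, -, b, rfl, hab⟩
      simpa [inNbrs] using hab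
    exact lt_of_lt_of_le (Nat.lt_succ_self f) (h.trans h1)

/-- If a node has only heard from itself in its current phase, but has more than `f` incoming
neighbours, then Condition `n`-WAIT does not hold. -/
theorem LWAState.Inv.not_wait {vals : V → List ℝ} {i : V} {s : LWAState V}
    (h : s.Inv G vals i) (hG : ∀ i, ¬ G.Adj i i) (hcard : f < (inNbrs G i).card)
    (hown : ∀ m ∈ s.handled, m.phase = s.phase → m.origin = i) : ¬ s.Wait f := by
  intro hw
  obtain ⟨L, hi, hL, hf⟩ := h.exists_closed hw
  have hLi : ∀ k ∈ L, k = i := by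
    intro k hk
    obtain ⟨m, hm, hp, rfl⟩ := hL hk
    exact hown m hm hp
  have hle : (inNbrs G i).card ≤ (inNbrsOfSet G Set.univ L).ncard := by
    rw [← Set.ncard_coe_finset]
    refine Set.ncard_le_ncard ?_ (Set.toFinite _)
    intro a ha
    have hai : G.Adj a i := by simpa [inNbrs] using ha
    refine ⟨trivial, fun haL => ?_, i, hi, hai⟩
    rw [hLi a haL] at hai
    exact hG i hai
  omega

/-- The first message in the inbox of a fault-free node is handled eventually. -/
theorem Run.exists_head_handled (r : Run (LWA (V := V) f) G x) (hr : r.Admissible f)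
    (hG : ∀ i, ¬ G.Adj i i) (hCCA : CCA G f) {i : V} (hi : i ∉ r.faulty) {t : ℕ}
    {s : LWAState V} (hs : (r.cfg t).loc i = some s) {m : LWAMsg V} {rest : List (LWAMsg V)}
    (hin : s.inbox = m :: rest) :
    ∃ t', ∃ s' : LWAState V, ∃ extra, (r.cfg t').loc i = some s' ∧
      s'.inbox = rest ++ extra ∧ m ∈ s'.handled := by
  by_contra! hcon
  have hcard : f < (inNbrs G i).card := by
    obtain ⟨j, hj⟩ := ((r.lwaInv t).node i s hs).inbox_nbr (by simp [hin])
    exact hCCA.lt_card_inNbrs hG hj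
  -- As long as `m` blocks the inbox, the node handles nothing new but its own messages.
  have hstuck : ∀ t' ≥ t, ∃ s' : LWAState V, ∃ extra, (r.cfg t').loc i = some s' ∧
      s'.inbox = m :: rest ++ extra ∧ ∀ m' ∈ s'.handled, m' ∈ s.handled ∨ m'.origin = i := by
    intro t' ht'
    induction t', ht' using Nat.le_induction with
    | base => exact ⟨s, [], hs, by simp [hin], fun m' hm' => Or.inl hm'⟩
    | succ t' _ ih =>
      obtain ⟨s', extra, hs', hin', hh⟩ := ih
      rcases (r.step t').idle_or_performs with ⟨h1, -, -, -⟩ | ⟨k, τ, a, sent, hp⟩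
      · exact ⟨s', extra, by rw [h1]; exact hs', hin', hh⟩
      · by_cases hik : i = k
        · subst hik
          have hloc := hp.loc_self
          have hself := ((r.lwaInv t').node i s' hs').self
          cases LWAMove.of_response hp.resp with
          | start _ _ h => rw [hs'] at h; simp at h
          | commit _ h =>
            rw [hs'] at h; obtain rfl := Option.some_injective _ h
            refine ⟨_, extra, hloc, hin', fun m' hm' => ?_⟩
            rcases LWAState.mem_enter_handled.1 hm' with rfl | hm'
            exacts [Or.inr hself, hh m' hm']
          | skip _ h _ hemp =>
            rw [hs'] at h; obtain rfl := Option.some_injective _ h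
            rw [hin'] at hemp
            simp at hemp
          | duplicate _ m' rest' h _ hin'' hm' =>
            rw [hs'] at h; obtain rfl := Option.some_injective _ h
            rw [hin', List.cons_append, List.cons.injEq] at hin''
            obtain ⟨rfl, rfl⟩ := hin''
            exact (hcon _ _ extra hloc rfl hm').elim
          | handle _ m' rest' handled h _ hin'' _ hm' =>
            rw [hs'] at h; obtain rfl := Option.some_injective _ h
            rw [hin', List.cons_append, List.cons.injEq] at hin''
            obtain ⟨rfl, rfl⟩ := hin''
            exact (hcon _ _ extra hloc rfl ((hm' m).2 (Or.inl rfl))).elim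
          | recv _ j m' h =>
            rw [hs'] at h; obtain rfl := Option.some_injective _ h
            exact ⟨_, extra ++ [m'], hloc, by simp [hin'], hh⟩
        · exact ⟨s', extra, by rw [hp.loc_of_ne hik]; exact hs', hin', hh⟩
  have htick : ∀ t' ≥ t, r.ev t' = .act i .tick → ∃ s' : LWAState V,
      (r.cfg t').loc i = some s' ∧ s'.Wait f ∧
      ((r.cfg (t' + 1)).vals i).length = ((r.cfg t').vals i).length + 1 := by
    intro t' ht' hev
    obtain ⟨a, sent, hp⟩ := r.performs_of_act hev
    obtain ⟨s', extra, hs', hin', -⟩ := hstuck t' ht'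
    have hloc := hp.loc_self
    have hvals := hp.vals_self
    cases LWAMove.of_response hp.resp with
    | commit _ h hw => exact ⟨_, h, hw, by simp [hvals]⟩
    | skip _ h _ hemp =>
      rw [hs'] at h; obtain rfl := Option.some_injective _ h
      rw [hin'] at hemp
      simp at hemp
    | duplicate _ m' rest' h _ hin'' hm' =>
      rw [hs'] at h; obtain rfl := Option.some_injective _ h
      rw [hin', List.cons_append, List.cons.injEq] at hin''
      obtain ⟨rfl, rfl⟩ := hin''
      exact (hcon _ _ extra hloc rfl hm').elim
    | handle _ m' rest' handled h _ hin'' _ hm' =>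
      rw [hs'] at h; obtain rfl := Option.some_injective _ h
      rw [hin', List.cons_append, List.cons.injEq] at hin''
      obtain ⟨rfl, rfl⟩ := hin''
      exact (hcon _ _ extra hloc rfl ((hm' m).2 (Or.inl rfl))).elim
  have hunbounded : ∀ N, ∃ t' ≥ t, N ≤ ((r.cfg t').vals i).length := by
    intro N
    induction N with
    | zero => exact ⟨t, le_rfl, Nat.zero_le _⟩
    | succ N ih =>
      obtain ⟨t₁, ht₁, hN⟩ := ih
      obtain ⟨t₂, ht₂, hev⟩ := hr.keeps_going i hi t₁
      obtain ⟨-, -, -, hl⟩ := htick t₂ (ht₁.trans ht₂) hev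
      have := (r.vals_prefix i ht₂).length_le
      exact ⟨t₂ + 1, by omega, by omega⟩
  obtain ⟨t₁, ht₁, hN⟩ := hunbounded (s.handled.sup LWAMsg.phase + 1)
  obtain ⟨t₂, ht₂, hev⟩ := hr.keeps_going i hi t₁
  obtain ⟨s', hs', hw, -⟩ := htick t₂ (ht₁.trans ht₂) hev
  obtain ⟨s'', -, hs'', -, hh⟩ := hstuck t₂ (ht₁.trans ht₂)
  rw [hs'] at hs''
  obtain rfl := Option.some_injective _ hs''
  have hinv := (r.lwaInv t₂).node i s' hs'
  refine hinv.not_wait hG hcard (fun m' hm' hph => (hh m' hm').resolve_left fun hold => ?_) hw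
  have h1 : m'.phase ≤ s.handled.sup LWAMsg.phase := Finset.le_sup (f := LWAMsg.phase) hold
  have h2 := (r.vals_prefix i ht₂).length_le
  have h3 := hinv.phase
  omega

theorem Run.exists_handled_of_inbox (r : Run (LWA (V := V) f) G x) (hr : r.Admissible f)
    (hG : ∀ i, ¬ G.Adj i i) (hCCA : CCA G f) {i : V} (hi : i ∉ r.faulty) {m : LWAMsg V}
    (l l' : List (LWAMsg V)) (t : ℕ) (s : LWAState V) (hs : (r.cfg t).loc i = some s)
    (hin : s.inbox = l ++ m :: l') : ∃ t', (r.cfg t').Handled i m := by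
  induction l generalizing l' t s with
  | nil =>
    obtain ⟨t', s', -, hs', -, hm⟩ := r.exists_head_handled hr hG hCCA hi hs hin
    exact ⟨t', s', hs', hm⟩
  | cons m' l ih =>
    obtain ⟨t', s', extra, hs', hin', -⟩ := r.exists_head_handled hr hG hCCA hi hs hin
    exact ih (l' ++ extra) t' s' hs' (by simpa using hin')

theorem Run.exists_handled_of_adj (r : Run (LWA (V := V) f) G x) (hr : r.Admissible f)
    (hG : ∀ i, ¬ G.Adj i i) (hCCA : CCA G f) {i j : V} (hi : i ∉ r.faulty) (hj : j ∉ r.faulty)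
    (hji : G.Adj j i) {m : LWAMsg V} {t : ℕ} (hm : (r.cfg t).Handled j m) :
    ∃ t', (r.cfg t').Handled i m := by
  obtain ⟨t', s, hs, h⟩ : ∃ t', (r.cfg t').Arrived i m := by
    rcases r.relayed t (fun h => hj ⟨t, h⟩) hji hm with h | h
    · obtain ⟨t', -, hev⟩ := hr.delivered i hi t j m h
      obtain ⟨a, sent, hp⟩ := r.performs_of_act hev
      refine ⟨t' + 1, a.next, hp.loc_self, Or.inl ?_⟩
      cases LWAMove.of_response hp.resp with
      | recv => exact List.mem_append_right _ (by simp)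
    · exact ⟨t, h⟩
  rcases h with h | h
  · obtain ⟨l, l', hl⟩ := List.append_of_mem h
    exact r.exists_handled_of_inbox hr hG hCCA hi l l' t' s hs hl
  · exact ⟨t', s, hs, h⟩

theorem Run.exists_handled_of_path (r : Run (LWA (V := V) f) G x) (hr : r.Admissible f)
    (hG : ∀ i, ¬ G.Adj i i) (hCCA : CCA G f) {i k : V}
    (hpath : Relation.ReflTransGen
      (fun a b => G.Adj a b ∧ a ∉ r.faulty ∧ b ∉ r.faulty) k i)
    {m : LWAMsg V} {t : ℕ} (hm : (r.cfg t).Handled k m) : ∃ t', (r.cfg t').Handled i m := by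
  induction hpath with
  | refl => exact ⟨t, hm⟩
  | tail _ hbc ih =>
    obtain ⟨t', ht'⟩ := ih
    exact r.exists_handled_of_adj hr hG hCCA hbc.2.2 hbc.2.1 hbc.1 ht'

/-- Condition `n`-WAIT holds once a node has heard from all nodes that have a fault-free
path to it. -/
theorem LWAState.Inv.wait_of_heard {vals : V → List ℝ} {i : V} {s : LWAState V}
    (h : s.Inv G vals i) {B : Set V} (hB : B.ncard ≤ f) (hi : i ∉ B)
    (hheard : ∀ k, k ∉ B →
      Relation.ReflTransGen (fun a b => G.Adj a b ∧ a ∉ B ∧ b ∉ B) k i →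
      k ∈ s.heard s.phase) : s.Wait f := by
  classical
  have hmem : ∀ k, k ∈ Finset.univ.filter (fun k => k ∈ B ∧ k ∈ (s.est s.phase).verts) ↔
      k ∈ B ∧ k ∈ (s.est s.phase).verts := by simp
  refine ⟨Finset.univ.filter fun k => k ∈ B ∧ k ∈ (s.est s.phase).verts, fun k hk => ?_, ?_, ?_⟩
  · rw [hmem] at hk
    refine ⟨hk.2, ?_⟩
    rw [h.self]
    rintro rfl
    exact hi hk.1
  · rw [← Set.ncard_coe_finset]
    refine (Set.ncard_le_ncard ?_ (Set.toFinite _)).trans hB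
    intro k hk
    exact ((hmem k).1 hk).1
  · rintro k ⟨hkv, hkS, hpath⟩
    rw [h.self] at hpath
    refine hheard k (fun hkB => hkS ((hmem k).2 ⟨hkB, hkv⟩)) (Relation.ReflTransGen.mono (fun a b => ?_) _ _ hpath)
    rintro ⟨⟨m, hm, -, ha, rfl⟩, ⟨hav, haS⟩, hbv, hbS⟩
    rw [(h.handled m hm).nbrs] at ha
    exact ⟨by simpa [inNbrs] using ha, fun haB => haS ((hmem a).2 ⟨haB, hav⟩),
      fun hbB => hbS ((hmem _).2 ⟨hbB, hbv⟩)⟩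

/-- By induction every fault-free node computes its state of phase `p` and so emits a message of
phase `p + 1`. These messages reach `i` along fault-free paths. If `i` stayed in phase `p + 1`, WAIT
would hold at its first tick after all of them were handled, and that tick commits. -/
theorem Run.exists_lt_length_vals (r : Run (LWA (V := V) f) G x) (hr : r.Admissible f)
    (hG : ∀ i, ¬ G.Adj i i) (hCCA : CCA G f) (p : ℕ) (i : V) (hi : i ∉ r.faulty) :
    ∃ t, p < ((r.cfg t).vals i).length := by
  classical
  have hstarted : ∀ i ∉ r.faulty, ∀ t', r.ev t' = .act i .tick →
      ∃ s : LWAState V, (r.cfg t').loc i = some s := by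
    intro i _ t' hev
    obtain ⟨a, sent, hp⟩ := r.performs_of_act hev
    cases LWAMove.of_response hp.resp with
    | commit s h => exact ⟨s, h⟩
    | skip s h => exact ⟨s, h⟩
    | duplicate s _ _ h => exact ⟨s, h⟩
    | handle s _ _ _ h => exact ⟨s, h⟩
  induction p generalizing i with
  | zero =>
    obtain ⟨t, -, hev⟩ := hr.keeps_going i hi 0
    obtain ⟨s, hs⟩ := hstarted i hi t hev
    rcases r.started_vals t i with ⟨h, -⟩ | ⟨-, l, h⟩
    · rw [hs] at h; simp at h
    · exact ⟨t, by simp [h]⟩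
  | succ p ih =>
    by_contra! hcon
    have hmsg : ∀ k, ∃ t, k ∉ r.faulty →
        Relation.ReflTransGen (fun a b => G.Adj a b ∧ a ∉ r.faulty ∧ b ∉ r.faulty) k i →
        ∃ m : LWAMsg V, m.origin = k ∧ m.phase = p + 1 ∧ (r.cfg t).Handled i m := by
      intro k
      by_cases hk : k ∉ r.faulty ∧
        Relation.ReflTransGen (fun a b => G.Adj a b ∧ a ∉ r.faulty ∧ b ∉ r.faulty) k i
      · obtain ⟨t, ht⟩ := ih k hk.1
        cases hs : (r.cfg t).loc k with
        | none =>
          rw [(r.lwaInv t).idle k hs] at ht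
          simp at ht
        | some s =>
          have hinv := (r.lwaInv t).node k s hs
          obtain ⟨m, hm, h1, h2⟩ := hinv.own (p + 1) (by omega) (by rw [hinv.phase]; omega)
          obtain ⟨t', ht'⟩ := r.exists_handled_of_path hr hG hCCA hk.2 (m := m) ⟨s, hs, hm⟩
          exact ⟨t', fun _ _ => ⟨m, h1, h2, ht'⟩⟩
      -- No message is needed from such a `k`; a time is still assigned so that `τ` is total and has
      -- a supremum over the finite node set.
      · exact ⟨0, fun h1 h2 => absurd ⟨h1, h2⟩ hk⟩
    choose τ hτ using hmsg
    obtain ⟨t₀, ht₀⟩ := ih i hi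
    obtain ⟨T, hT, hev⟩ := hr.keeps_going i hi (max t₀ (Finset.univ.sup τ))
    have hlen : ((r.cfg T).vals i).length = p + 1 := by
      have h1 := hcon T
      have h2 := (r.vals_prefix i ((le_max_left _ _).trans hT)).length_le
      omega
    obtain ⟨s, hs⟩ := hstarted i hi T hev
    have hinv := (r.lwaInv T).node i s hs
    have hw : s.Wait f := by
      refine hinv.wait_of_heard hr.few_faults hi fun k hk hpath => ?_
      obtain ⟨m, h1, h2, h3⟩ := hτ k hk hpath
      have hle : τ k ≤ T :=
        (Finset.le_sup (f := τ) (Finset.mem_univ k)).trans ((le_max_right _ _).trans hT)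
      obtain ⟨s', hs', hm⟩ := r.handled_mono hle h3
      rw [hs] at hs'
      obtain rfl := Option.some_injective _ hs'
      exact ⟨m, hm, by rw [h2, hinv.phase, hlen], h1⟩
    obtain ⟨a, sent, hp⟩ := r.performs_of_act hev
    have hvals := hp.vals_self
    cases LWAMove.of_response hp.resp with
    | commit _ h =>
      have h1 := hcon (T + 1)
      rw [hvals] at h1
      simp [hlen] at h1
    | skip _ h hnw =>
      rw [hs] at h; obtain rfl := Option.some_injective _ h; exact hnw hw
    | duplicate _ _ _ h hnw =>
      rw [hs] at h; obtain rfl := Option.some_injective _ h; exact hnw hw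
    | handle _ _ _ _ h hnw =>
      rw [hs] at h; obtain rfl := Option.some_injective _ h; exact hnw hw

theorem CCA.progress (h : CCA G f) (hG : ∀ i, ¬ G.Adj i i)
    (r : Run (LWA (V := V) f) G x) (hr : r.Admissible f) : r.Progress := by
  intro i hi p hF
  obtain ⟨t, ht⟩ := r.exists_lt_length_vals hr hG h p i hi
  obtain ⟨y, hy⟩ := Run.hasState_of_lt ht
  exact hF y hy

/-- The geometric bound on the range involves only the number of nodes and the inputs, so the
threshold phase read off from it serves all executions at once. -/
theorem CCA.lwa_solvesApproxConsensus [Nonempty V] (h : CCA G f) (hG : ∀ i, ¬ G.Adj i i) :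
    SolvesApproxConsensus (LWA f) G f := by
  intro x
  refine ⟨fun r hr => ⟨h.progress hG r hr, r.lwa_validity⟩, fun ε hε => ?_⟩
  have hev := (tendsto_one_sub_inv_card_pow_mul (V := V) (2 * ∑ i, |x i|)).eventually
    (gt_mem_nhds hε)
  obtain ⟨N, hN⟩ := Filter.eventually_atTop.1 hev
  exact ⟨N, fun r _ p hp => (h.U_sub_mu_le_pow r p).trans_lt (hN p hp.le)⟩

end Progress

end AsyncConsensus

theorem mainTheorem4 {V : Type*} [Fintype V] (hn : 2 ≤ Fintype.card V)
    (G : Digraph V) (hG : ∀ i, ¬ G.Adj i i) (f : ℕ) :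
    (AsyncConsensus.CCA G f →
      (∀ (x : V → ℝ) (r : AsyncConsensus.Run (AsyncConsensus.LWA f) G x), r.Admissible f →
        (∀ p ≥ 1, ∀ i j : V, i ∉ r.F p → j ∉ r.F p →
          (AsyncConsensus.heardStar r i p ∩ AsyncConsensus.heardStar r j p).Nonempty) ∧
        r.Progress ∧ r.Validity ∧ r.Convergence) ∧
      AsyncConsensus.SolvesApproxConsensus (AsyncConsensus.LWA f) G f) ∧
    ((∃ P : AsyncConsensus.Protocol V, AsyncConsensus.SolvesApproxConsensus P G f) ↔
      AsyncConsensus.CCA G f) := by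
  have : Nonempty V := Fintype.card_pos_iff.1 (by omega)
  refine ⟨fun h => ⟨fun x r hr => ⟨fun p hp i j hi hj => h.heardStar_inter_nonempty r hp hi hj,
    h.progress hG r hr, r.lwa_validity, h.convergence r⟩, h.lwa_solvesApproxConsensus hG⟩,
    fun ⟨_, hP⟩ => hP.cca, fun h => ⟨_, h.lwa_solvesApproxConsensus hG⟩⟩
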